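/- **Setting.** Let $m\ge 1$, $d\ge 0$. A multiscale problem is $\min_{x\in\mathbb R^d} f(x)=\sum_{i=1}^m f_i(P_ix)$, where $P_i\in\mathbb R^{d_i\times d}$ satisfy $P_iP_i^\top=I$, $P_iP_j^\top=0$ for $i\ne j$, $\sum_i d_i=d$, and $f_i:\mathbb R^{d_i}\to\mathbb R$ is $\mu_i$-strongly convex and $L_i$-smooth with $0<\mu_i\le L_i$ and $L_i<\mu_{i+1}$. Put $\kappa_i=L_i/\mu_i$, $\kappa=L_m/\mu_1$, let $x^\star$ be the minimizer of $f$, and $$\psi(x,v)=\sum_{i=1}^m\Big(f_i(P_ix)-\min f_i+\tfrac{\mu_i}{2}\|P_i(v-x^\star)\|_2^2\Big).$$ For $L\ge\mu>0$, one step $(x_+,v_+)=\mathrm{AGD}(x,v;L,\mu)$ is: with $k=L/\mu$, $\alpha=\frac{\sqrt k}{\sqrt k+1}$, $\beta=1-\frac1{\sqrt k}$ and $y=\alpha x+(1-\alpha)v$, set $x_+=y-\frac1L\nabla f(y)$ and $v_+=\beta v+(1-\beta)\big(y-\frac1\mu\nabla f(y)\big)$. Given $T_1,\dots,T_m\in\mathbb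 N$, $\mathrm{AcBSLS}_i(x^{(0)},v^{(0)})$ performs for $t=0,\dots,T_i-1$: $(\tilde x,\tilde v)\leftarrow\mathrm{AGD}(x^{(t)},v^{(t)};L_i,\mu_i)$; if $i<m$, then $x^{(t+1)}$ is the first component of $\mathrm{AcBSLS}_{i+1}(\tilde x,\tilde x)$ and $v^{(t+1)}$ is the second component of $\mathrm{AcBSLS}_{i+1}(\tilde v,\tilde v)$; if $i=m$, then $(x^{(t+1)},v^{(t+1)})=(\tilde x,\tilde v)$. It returns $(x^{(T_i)},v^{(T_i)})$. A routine $\widehat{\mathrm{AGD}}$ is *$\delta$-accurate* at $(L,\mu)$ if for all $x,v$ the outputs $(\hat x_+,\hat v_+)=\widehat{\mathrm{AGD}}(x,v;L,\mu)$ and $(x_+,v_+)=\mathrm{AGD}(x,v;L,\mu)$ satisfy $|\hat x_+-x_+|\le\delta|x_+|$ and $|\hat v_+-v_+|\le\delta|v_+|$ elementwise. $\widehat{\mathrm{AcBSLS}}_i$ denotes $\mathrm{AcBSLS}_i$ with $\mathrm{AGD}$ replaced by $\widehat{\mathrm{AGD}}$. **Theorem.** Let $\varepsilon>0$. **(1)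 Known parameters, arbitrary start.** Let $x^{(0)},v^{(0)}\in\mathbb R^d$, $\psi_0=\psi(x^{(0)},v^{(0)})$, and let $T_1\ge\sqrt{\kappa_1}\log(\psi_0/\varepsilon)$ and $T_i\ge\sqrt{\kappa_i}\,(\log(4\kappa^4)+1)$ for $i=2,\dots,m$ (as in exact arithmetic). Let $0<\delta<1$, let $\widehat{\mathrm{AGD}}$ be $\delta$-accurate at $(L_i,\mu_i)$ for every $i$, and let $$\delta^{-1}\ \ge\ B:=\Big(\prod_{i=1}^mT_i\Big)\max\Big\{2(10\kappa^2)^{2m-1},\ 2(10\kappa^2)^{2m-1}m\,\frac{\psi_0}{\varepsilon},\ 4\cdot3^{m+1}\,mL_m\kappa\,\frac{\|x^\star\|_2^2}{\varepsilon}\Big\}.$$ Then $\psi\big(\widehat{\mathrm{AcBSLS}}_1(x^{(0)},v^{(0)})\big)\le3\varepsilon$. **(2) Known parameters, start at zero.** Let $T_1,\dots,T_m$ satisfy the same bounds with $\psi_0=\psi(0,0)$, let $0<\delta<1$, let $\widehat{\mathrm{AGD}}$ be $\delta$-accurate at $(L_i,\mu_i)$ for every $i$, and let $$\delta^{-1}\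 \ge\ B_0:=4m\Big(\prod_{i=1}^mT_i\Big)(10\kappa^2)^{2m-1}\,\frac{\psi(0,0)}{\varepsilon}.$$ Then $\min\{\psi(0,0),\ \psi(\widehat{\mathrm{AcBSLS}}_1(0,0))\}\le3\varepsilon$. **(3) Logarithmically many bits suffice.** If $\widehat{\mathrm{AGD}}$ rounds every coordinate of the exact AGD output to the nearest floating-point number with $p$ significant bits (no overflow or underflow), then the conclusion of (1) holds whenever $p\ge\log_2B$ and the conclusion of (2) holds whenever $p\ge\log_2B_0$ (with $\log_20$ read as $0$). **(4) Unknown parameters.** Suppose that the $(\mu_i,L_i)$, $P_i$, $f_i$ are unknown and only $m$, $\mu_1$, $L_m$, $\pi=\prod_i\kappa_i$ are known, together with the start, $\varepsilon$ and an upper bound $\Psi\ge\psi(x^{(0)},v^{(0)})$. Put $$R=\sqrt{\pi}\,(1+\log\kappa)^{m-1}\Big(1+\max\big\{0,\log\tfrac{\Psi}{\varepsilon}\big\}\Big).$$ There is a constant $C=C(m)>0$ and a deterministic adaptive algorithm that uses only these known data, calls of $\widehat{\mathrm{AGD}}(\cdot,\cdot;L,\mu)$ and values of $f$, such that the following holds.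 If $\widehat{\mathrm{AGD}}$ is $\delta$-accurate at all $(L,\mu)$ with $\mu_1\le\mu\le L\le L_m$, where $0<\delta<1$, and $$\delta^{-1}\ge C\,R\,\max\Big\{\kappa^{2(2m-1)},\ \kappa^{2(2m-1)}\frac{\Psi}{\varepsilon},\ L_m\kappa\frac{\|x^\star\|_2^2}{\varepsilon}\Big\}$$ (or, for the start at zero, only $\delta^{-1}\ge C\,R\,\kappa^{2(2m-1)}\Psi/\varepsilon$), then the algorithm outputs a point $\hat x$ with $\psi(\hat x,\hat x)\le3\varepsilon$, in particular $f(\hat x)-f(x^\star)\le3\varepsilon$, after at most $C\,R\,(1+\log\kappa)^{e}$ calls, where $e=\max\{0,2m-3\}$; that is, it attains the complexity $\tilde O(\prod_i\sqrt{\kappa_i})$ of the case of known parameters up to a factor polylogarithmic in $\kappa$ for fixed $m$. -/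

import Mathlib

noncomputable section

/-- `ℝᵈ` with the Euclidean norm. -/
abbrev Vec (d : ℕ) : Type := EuclideanSpace ℝ (Fin d)

/-- The index of the last (least smooth) scale; the first one is `0`. -/
def lastScale (m : ℕ) [NeZero m] : Fin m :=
  ⟨m - 1, Nat.sub_lt (NeZero.pos m) Nat.one_pos⟩

/-- `g` is differentiable with `L`-Lipschitz gradient. -/
def IsSmooth {n : ℕ} (L : ℝ) (g : Vec n → ℝ) : Prop :=
  Differentiable ℝ g ∧ ∀ x y, ‖gradient g x - gradient g y‖ ≤ L * ‖x - y‖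

/-- A multiscale convex problem on `ℝᵈ` with `m` scales. -/
structure MultiscaleProblem (d m : ℕ) where
  /-- dimensions of the blocks -/
  dim : Fin m → ℕ
  /-- strong convexity constants -/
  μ : Fin m → ℝ
  /-- smoothness constants -/
  L : Fin m → ℝ
  /-- the projections -/
  proj : (i : Fin m) → Matrix (Fin (dim i)) (Fin d) ℝ
  /-- the sub-objectives -/
  sub : (i : Fin m) → Vec (dim i) → ℝ
  μ_pos : ∀ i, 0 < μ i
  μ_le_L : ∀ i, μ i ≤ L i
  L_lt_μ : ∀ i j, i < j → L i < μ j
  proj_self : ∀ i, proj i * (proj i).transpose = 1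
  proj_orth : ∀ i j, i ≠ j → proj i * (proj j).transpose = 0
  /-- The blocks exhaust `ℝᵈ`, so that the objective is strongly convex on `ℝᵈ`. -/
  sum_dim : ∑ i, dim i = d
  strong_convex : ∀ i, StrongConvexOn Set.univ (μ i) (sub i)
  smooth : ∀ i, IsSmooth (L i) (sub i)

namespace MultiscaleProblem

variable {d m : ℕ} (Q : MultiscaleProblem d m)

/-- The product `Pᵢ x`. -/
def block (i : Fin m) (x : Vec d) : Vec (Q.dim i) := WithLp.toLp 2 ((Q.proj i).mulVec x.ofLp)

/-- The objective `f(x) = ∑ᵢ fᵢ(Pᵢ x)`. -/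
def obj (x : Vec d) : ℝ := ∑ i, Q.sub i (Q.block i x)

/-- The condition number `κᵢ = Lᵢ / μᵢ`. -/
def cond (i : Fin m) : ℝ := Q.L i / Q.μ i

/-- The global condition number `L_m / μ₁`. -/
def globalCond [NeZero m] : ℝ := Q.L (lastScale m) / Q.μ 0

/-- The functional error `fᵢ(Pᵢ x) - min fᵢ`. -/
def err (i : Fin m) (x : Vec d) : ℝ := Q.sub i (Q.block i x) - ⨅ y, Q.sub i y

/-- The residual `(μᵢ / 2) ‖Pᵢ (x - x⋆)‖²`. -/
def res (xstar : Vec d) (i : Fin m) (x : Vec d) : ℝ :=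
  Q.μ i / 2 * ‖Q.block i (x - xstar)‖ ^ 2

/-- The potential `ψ(x, v) = ∑ᵢ (errᵢ(x) + resᵢ(v))`, evaluated at a pair. -/
def psi (xstar : Vec d) (z : Vec d × Vec d) : ℝ := ∑ i, (Q.err i z.1 + Q.res xstar i z.2)

/-- The lower bounds on the iteration counts (with potential value `ψ₀` at the start). -/
def IterBounds [NeZero m] (ψ₀ ε : ℝ) (T : Fin m → ℕ) : Prop :=
  √(Q.cond 0) * Real.log (ψ₀ / ε) ≤ T 0 ∧
    ∀ i, i ≠ 0 → √(Q.cond i) * (Real.log (4 * Q.globalCond ^ 4) + 1) ≤ T i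

/-- The lower bound on `δ⁻¹` for an arbitrary initialization. -/
def precGeneral [NeZero m] (xstar : Vec d) (z₀ : Vec d × Vec d) (ε : ℝ) (T : Fin m → ℕ) : ℝ :=
  (∏ i, (T i : ℝ)) *
    max (2 * (10 * Q.globalCond ^ 2) ^ (2 * m - 1))
      (max (2 * (10 * Q.globalCond ^ 2) ^ (2 * m - 1) * m * (Q.psi xstar z₀ / ε))
        (4 * 3 ^ (m + 1) * (m * Q.L (lastScale m) * Q.globalCond) * (‖xstar‖ ^ 2 / ε)))

/-- The lower bound on `δ⁻¹` for the initialization at `(0, 0)`. -/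
def precZero [NeZero m] (xstar : Vec d) (ε : ℝ) (T : Fin m → ℕ) : ℝ :=
  4 * m * (∏ i, (T i : ℝ)) * (10 * Q.globalCond ^ 2) ^ (2 * m - 1) * (Q.psi xstar (0, 0) / ε)

end MultiscaleProblem

/-- The type of (exact or approximate) implementations of one step `AGD(x, v; L, μ)`, with the
arguments in the order `x v L μ`. -/
abbrev AGDRoutine (d : ℕ) : Type := Vec d → Vec d → ℝ → ℝ → Vec d × Vec d

/-- One exact step of accelerated gradient descent for `f`. -/
def exactAGD {d : ℕ} (f : Vec d → ℝ) : AGDRoutine d := fun x v L μ =>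
  let κ : ℝ := L / μ
  let α : ℝ := √κ / (√κ + 1)
  let β : ℝ := 1 - 1 / √κ
  let y : Vec d := α • x + (1 - α) • v
  (y - (1 / L) • gradient f y, β • v + (1 - β) • (y - (1 / μ) • gradient f y))

/-- `xh` is an elementwise `δ`-multiplicative approximation of `x`. -/
def MulApprox {d : ℕ} (δ : ℝ) (xh x : Vec d) : Prop := ∀ k, |xh k - x k| ≤ δ * |x k|

/-- With parameters `L`, `μ`, the routine `agd` is `δ`-multiplicatively accurate at all `x`, `v`. -/
def AccurateAt {d : ℕ} (f : Vec d → ℝ) (δ : ℝ) (agd : AGDRoutine d) (L μ : ℝ) : Prop :=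
  ∀ x v, MulApprox δ (agd x v L μ).1 (exactAGD f x v L μ).1 ∧
    MulApprox δ (agd x v L μ).2 (exactAGD f x v L μ).2

/-- The recursive procedure `AcBSLSᵢ` run with the given implementation of AGD. In each of the
`T i` rounds one AGD step is made; if `i` is not the last scale, the two outputs of this step are
then treated by two separate calls of the procedure for the next scale. -/
def acbsls {d m : ℕ} (agd : AGDRoutine d) (L μ : Fin m → ℝ) (T : Fin m → ℕ)
    (i : Fin m) (z : Vec d × Vec d) : Vec d × Vec d :=
  (fun u : Vec d × Vec d =>
    let w := agd u.1 u.2 (L i) (μ i)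
    if h : i.val + 1 < m then
      ((acbsls agd L μ T ⟨i.val + 1, h⟩ (w.1, w.1)).1,
        (acbsls agd L μ T ⟨i.val + 1, h⟩ (w.2, w.2)).2)
    else w)^[T i] z
termination_by m - i.val

/-- Rounding of a real number to the nearest floating-point number with `p` significant bits
(no overflow or underflow). -/
def roundBits (p : ℕ) (t : ℝ) : ℝ :=
  (round (t * (2 : ℝ) ^ ((p : ℤ) - 1 - Int.log 2 |t|)) : ℝ) *
    (2 : ℝ) ^ (Int.log 2 |t| + 1 - (p : ℤ))

/-- Coordinatewise rounding to `p` significant bits. -/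
def roundVec {d : ℕ} (p : ℕ) (x : Vec d) : Vec d := WithLp.toLp 2 fun k => roundBits p (x k)

/-- AGD whose output is correctly rounded to `p` significant bits. -/
def roundedAGD {d : ℕ} (p : ℕ) (f : Vec d → ℝ) : AGDRoutine d := fun x v L μ =>
  (roundVec p (exactAGD f x v L μ).1, roundVec p (exactAGD f x v L μ).2)

/-- Deterministic adaptive programs that see the objective only through calls of an AGD routine
(with parameters of their choice) and through values of the objective, and output a point. -/
inductive OracleProgram (E : Type) : Type
  | output (x : E) : OracleProgram E
  | agdStep (x v : E) (L μ : ℝ) (next : E × E → OracleProgram E) : OracleProgram E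
  | value (x : E) (next : ℝ → OracleProgram E) : OracleProgram E

namespace OracleProgram

/-- The point that the program outputs. -/
def run {d : ℕ} (agd : AGDRoutine d) (f : Vec d → ℝ) : OracleProgram (Vec d) → Vec d
  | output x => x
  | agdStep x v L μ next => run agd f (next (agd x v L μ))
  | value x next => run agd f (next (f x))

/-- The number of oracle calls (AGD steps and function values) that the program makes. -/
def queries {d : ℕ} (agd : AGDRoutine d) (f : Vec d → ℝ) : OracleProgram (Vec d) → ℕ
  | output _ => 0
  | agdStep x v L μ next => queries agd f (next (agd x v L μ)) + 1
  | value x next => queries agd f (next (f x)) + 1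

end OracleProgram

/-- The order of the query complexity `√(∏ κᵢ) · log^{m-1} κ · log (ψ₀ / ε)` of the accelerated
method with known parameters, as a function of `m`, `π = ∏ κᵢ`, the global condition number `κ`
and `ρ = ψ₀ / ε`. -/
def acRate (m : ℕ) (π κ ρ : ℝ) : ℝ :=
  √π * (1 + Real.log κ) ^ (m - 1) * (1 + max 0 (Real.log ρ))

end

/-! The rows of the `Pᵢ` form an orthonormal basis, so an AGD step for `f` acts on each block as an
AGD step for `fᵢ` with the same parameters. A step tuned to scale `i` contracts the potential of
block `i` (`exactAGD_contracts`). On blocks `j < i` it is harmless: its step lengths are at most `2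
/ Lⱼ`, so it increases neither value nor distance to the minimizer beyond the larger of the two
inputs. On blocks `j > i` it may expand distances by up to `κ`, and the calls at scale `i + 1` undo
this, because their iteration counts absorb a factor `2κ²` (`CallBound.inner_round`).

Errors are tracked on square roots of potentials, which answer a perturbation of norm `η` by an
additive `√Lⱼ η` (`sqrt_pot_le_add`). Hence errors only add up, and a call is described by a
contraction factor and a number of errors (`CallBound`), bounded in `acbsls_bound`. The size `η` is
relative to the norms of the exact step outputs, which depend on `η` in turn; a small `δ` closes
this loop (`feedback_le`), and `sum_pot_acbsls_le` follows. For the start at zero, either `ψ(0,0) ≤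
ε`, or the requirement on `ψ(0,0)/ε` implies the others, as `μ₁‖x⋆‖² ≤ ψ(0,0)`. Rounding to `p` bits
has relative error at most `2⁻ᵖ`.

For unknown parameters, a geometric grid of guesses is tried. The estimates only need bounds on the
parameters and scales separated up to a factor two (`Admissible`), so a grid point near the true
parameters suffices (`exists_admissible_grid`). Choosing the last `μ` through the known product
bounds the cost of every guess and saves one grid dimension. The candidate with least `f` wins,
since `ψ(x, x) ≤ 2 (f(x) - f(x⋆))`. -/

open scoped RealInnerProductSpace

/-! ### Gradient steps for one smooth strongly convex function. -/

section SingleFunction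

variable {n : ℕ} {L μ : ℝ} {g : Vec n → ℝ} {c : Vec n}

lemma inner_gradient_eq_fderiv (x u : Vec n) : ⟪gradient g x, u⟫ = fderiv ℝ g x u := by
  simp [gradient]

lemma hasDerivAt_comp_line (hg : Differentiable ℝ g) (x u : Vec n) (t : ℝ) :
    HasDerivAt (fun s : ℝ => g (x + s • u)) ⟪gradient g (x + t • u), u⟫ t := by
  rw [inner_gradient_eq_fderiv]
  have h1 : HasDerivAt (fun s : ℝ => x + s • u) u t := by
    simpa using ((hasDerivAt_id t).smul_const u).const_add x
  exact (hg (x + t • u)).hasFDerivAt.comp_hasDerivAt t h1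

lemma IsSmooth.le_quadratic (hg : IsSmooth L g) (x u : Vec n) :
    g (x + u) ≤ g x + ⟪gradient g x, u⟫ + L / 2 * ‖u‖ ^ 2 := by
  let φ : ℝ → ℝ := fun t => g (x + t • u) - t * ⟪gradient g x, u⟫ - t ^ 2 * (L / 2 * ‖u‖ ^ 2)
  have hφ : ∀ t, HasDerivAt φ (⟪gradient g (x + t • u), u⟫ - ⟪gradient g x, u⟫
      - 2 * t * (L / 2 * ‖u‖ ^ 2)) t := by
    intro t
    have h2 : HasDerivAt (fun t : ℝ => t ^ 2 * (L / 2 * ‖u‖ ^ 2)) (2 * t * (L / 2 * ‖u‖ ^ 2)) t := by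
      simpa using (hasDerivAt_pow 2 t).mul_const (L / 2 * ‖u‖ ^ 2)
    have h3 : HasDerivAt (fun t : ℝ => t * ⟪gradient g x, u⟫) ⟪gradient g x, u⟫ t := by
      simpa using (hasDerivAt_id t).mul_const ⟪gradient g x, u⟫
    exact ((hasDerivAt_comp_line hg.1 x u t).sub h3).sub h2
  have hanti : AntitoneOn φ (Set.Icc 0 1) := by
    apply antitoneOn_of_deriv_nonpos (convex_Icc 0 1)
    · exact fun t _ => (hφ t).continuousAt.continuousWithinAt
    · exact fun t _ => (hφ t).differentiableAt.differentiableWithinAt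
    · intro t ht
      rw [interior_Icc] at ht
      rw [(hφ t).deriv, ← inner_sub_left]
      have h1 := real_inner_le_norm (gradient g (x + t • u) - gradient g x) u
      have h2 := hg.2 (x + t • u) x
      rw [add_sub_cancel_left, norm_smul, Real.norm_of_nonneg ht.1.le] at h2
      have h3 := mul_le_mul_of_nonneg_right h2 (norm_nonneg u)
      nlinarith
  have h := hanti (Set.left_mem_Icc.2 zero_le_one) (Set.right_mem_Icc.2 zero_le_one) zero_le_one
  simp only [φ, one_smul, zero_smul, add_zero] at h
  linarith

lemma StrongConvexOn.quadratic_le (hc : StrongConvexOn Set.univ μ g) (hg : Differentiable ℝ g)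
    (x u : Vec n) : g x + ⟪gradient g x, u⟫ + μ / 2 * ‖u‖ ^ 2 ≤ g (x + u) := by
  have hd : HasDerivAt (fun s : ℝ => g (x + s • u)) ⟪gradient g x, u⟫ 0 := by
    simpa using hasDerivAt_comp_line hg x u 0
  have h1 := hd.tendsto_slope_zero_right
  have h2 : Filter.Tendsto (fun t : ℝ => g (x + u) - g x - (1 - t) * (μ / 2 * ‖u‖ ^ 2))
      (nhdsWithin 0 (Set.Ioi 0)) (nhds (g (x + u) - g x - (1 - 0) * (μ / 2 * ‖u‖ ^ 2))) := by
    apply Filter.Tendsto.mono_left _ nhdsWithin_le_nhds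
    exact Continuous.tendsto (by fun_prop) _
  have h3 := le_of_tendsto_of_tendsto h1 h2 (by
    filter_upwards [Ioo_mem_nhdsGT (zero_lt_one' ℝ)] with t ht
    have h := hc.2 (Set.mem_univ x) (Set.mem_univ (x + u)) (sub_nonneg.2 ht.2.le) ht.1.le
      (sub_add_cancel 1 t)
    have e1 : (1 - t) • x + t • (x + u) = x + t • u := by
      rw [smul_add, sub_smul, one_smul]; abel
    have e2 : ‖x - (x + u)‖ = ‖u‖ := by rw [sub_add_cancel_left, norm_neg]
    rw [e1, e2] at h
    simp only [smul_eq_mul] at h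
    simp only [zero_add, zero_smul, add_zero, smul_eq_mul]
    rw [inv_mul_le_iff₀ ht.1]
    linarith)
  linarith

lemma gradient_eq_zero_of_forall_le (hmin : ∀ x, g c ≤ g x) : gradient g c = 0 := by
  have : IsLocalMin g c := Filter.Eventually.of_forall hmin
  simp [gradient, this.fderiv_eq_zero]

lemma IsSmooth.sub_min_le (hg : IsSmooth L g) (hmin : ∀ x, g c ≤ g x) (x : Vec n) :
    g x - g c ≤ L / 2 * ‖x - c‖ ^ 2 := by
  have h := hg.le_quadratic c (x - c)
  rw [gradient_eq_zero_of_forall_le hmin, inner_zero_left, add_sub_cancel] at h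
  linarith

lemma StrongConvexOn.le_sub_min (hc : StrongConvexOn Set.univ μ g) (hg : Differentiable ℝ g)
    (hmin : ∀ x, g c ≤ g x) (x : Vec n) : μ / 2 * ‖x - c‖ ^ 2 ≤ g x - g c := by
  have h := hc.quadratic_le hg c (x - c)
  rw [gradient_eq_zero_of_forall_le hmin, inner_zero_left, add_sub_cancel] at h
  linarith

lemma IsSmooth.step_le (hg : IsSmooth L g) (h : ℝ) (y : Vec n) :
    g (y - h • gradient g y) ≤ g y - (h - L / 2 * h ^ 2) * ‖gradient g y‖ ^ 2 := by
  have h1 := hg.le_quadratic y (-(h • gradient g y))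
  rw [inner_neg_right, inner_smul_right, real_inner_self_eq_norm_sq, norm_neg, norm_smul,
    mul_pow, Real.norm_eq_abs, sq_abs, ← sub_eq_add_neg] at h1
  linarith

lemma IsSmooth.sq_norm_gradient_le (hg : IsSmooth L g) (hL : 0 < L) (hmin : ∀ x, g c ≤ g x)
    (y : Vec n) : ‖gradient g y‖ ^ 2 ≤ 2 * L * (g y - g c) := by
  have h1 := (hmin _).trans (hg.step_le (1 / L) y)
  have e : 1 / L - L / 2 * (1 / L) ^ 2 = 1 / (2 * L) := by field_simp; ring
  rw [e, one_div, inv_mul_eq_div] at h1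
  have h2 : ‖gradient g y‖ ^ 2 / (2 * L) ≤ g y - g c := by linarith
  rw [div_le_iff₀ (by positivity)] at h2
  linarith

/-- Compare at the point `c + ∇g(y)/L`: smoothness at `c` bounds `g` there from above, convexity at
`y` from below. -/
lemma IsSmooth.cocoercive (hg : IsSmooth L g) (hL : 0 < L) (hμ : 0 ≤ μ)
    (hc : StrongConvexOn Set.univ μ g) (hmin : ∀ x, g c ≤ g x) (y : Vec n) :
    ‖gradient g y‖ ^ 2 ≤ L * ⟪gradient g y, y - c⟫ := by
  have h1 := hg.sub_min_le hmin (c + (1 / L) • gradient g y)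
  have h2 := hc.quadratic_le hg.1 y ((c + (1 / L) • gradient g y) - y)
  have h3 := hg.sq_norm_gradient_le hL hmin y
  have h4 : 0 ≤ μ / 2 * ‖(c + (1 / L) • gradient g y) - y‖ ^ 2 := by positivity
  have e : (c + (1 / L) • gradient g y) - y = (1 / L) • gradient g y - (y - c) := by abel
  rw [add_sub_cancel, e, inner_sub_right, inner_smul_right, real_inner_self_eq_norm_sq] at h2
  rw [add_sub_cancel_left, norm_smul, mul_pow, Real.norm_eq_abs, sq_abs] at h1
  rw [e] at h4
  have h5 : L * (1 / L * ‖gradient g y‖ ^ 2) = ‖gradient g y‖ ^ 2 := by field_simp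
  have h6 : L * (L / 2 * ((1 / L) ^ 2 * ‖gradient g y‖ ^ 2)) = ‖gradient g y‖ ^ 2 / 2 := by
    field_simp
  nlinarith

/-- The gradient is at most `2 √(L/2) √(g - min g)`, so the quadratic upper bound is at most a
perfect square. This Lipschitz property is what makes errors additive later. -/
lemma IsSmooth.sqrt_sub_min_le (hg : IsSmooth L g) (hL : 0 < L) (hmin : ∀ x, g c ≤ g x)
    (x u : Vec n) : √(g (x + u) - g c) ≤ √(g x - g c) + √(L / 2) * ‖u‖ := by
  apply Real.sqrt_le_iff.2 ⟨by positivity, ?_⟩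
  have h1 := hg.le_quadratic x u
  have h2 := hg.sq_norm_gradient_le hL hmin x
  have h0 : 0 ≤ g x - g c := sub_nonneg.2 (hmin x)
  have h3 : ‖gradient g x‖ ≤ 2 * (√(L / 2) * √(g x - g c)) := by
    apply abs_le_of_sq_le_sq' _ (by positivity) |>.2
    rw [mul_pow, mul_pow, Real.sq_sqrt h0, Real.sq_sqrt (by positivity)]
    linarith
  have h4 := (real_inner_le_norm (gradient g x) u).trans
    (mul_le_mul_of_nonneg_right h3 (norm_nonneg u))
  rw [add_sq, mul_pow, Real.sq_sqrt h0, Real.sq_sqrt (by positivity)]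
  linarith

lemma IsSmooth.step_le_self (hg : IsSmooth L g) {h : ℝ} (h0 : 0 ≤ h) (hL : h * L ≤ 2)
    (y : Vec n) : g (y - h • gradient g y) ≤ g y := by
  have h1 := hg.step_le h y
  have h2 : 0 ≤ (h - L / 2 * h ^ 2) * ‖gradient g y‖ ^ 2 := by
    apply mul_nonneg _ (sq_nonneg _)
    nlinarith
  linarith

lemma IsSmooth.norm_gradient_le (hg : IsSmooth L g) (hmin : ∀ x, g c ≤ g x) (y : Vec n) :
    ‖gradient g y‖ ≤ L * ‖y - c‖ := by
  have := hg.2 y c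
  rwa [gradient_eq_zero_of_forall_le hmin, sub_zero] at this

lemma norm_step_sub_sq (h : ℝ) (y : Vec n) :
    ‖y - h • gradient g y - c‖ ^ 2 =
      ‖y - c‖ ^ 2 - 2 * h * ⟪gradient g y, y - c⟫ + h ^ 2 * ‖gradient g y‖ ^ 2 := by
  rw [sub_right_comm, norm_sub_sq_real, inner_smul_right, norm_smul, mul_pow, Real.norm_eq_abs,
    sq_abs, real_inner_comm]
  ring

/-- A gradient step expands distances to the minimizer at most by `K`, if `h L ≤ K + 1`. -/
lemma IsSmooth.norm_step_sub_le (hg : IsSmooth L g) (hL : 0 < L) (hμ : 0 ≤ μ)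
    (hc : StrongConvexOn Set.univ μ g) (hmin : ∀ x, g c ≤ g x) {h K : ℝ} (h0 : 0 ≤ h)
    (hK : 1 ≤ K) (hL' : h * L ≤ K + 1) (y : Vec n) :
    ‖y - h • gradient g y - c‖ ≤ K * ‖y - c‖ := by
  apply abs_le_of_sq_le_sq' _ (by positivity) |>.2
  rw [norm_step_sub_sq]
  have h1 := hg.cocoercive hL hμ hc hmin y
  have h2 := hg.norm_gradient_le hmin y
  have h3 := (real_inner_le_norm (gradient g y) (y - c)).trans
    (mul_le_mul_of_nonneg_right h2 (norm_nonneg _))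
  have h4 : 0 ≤ ⟪gradient g y, y - c⟫ := by
    by_contra hneg
    push Not at hneg
    nlinarith [sq_nonneg ‖gradient g y‖]
  have h5 := mul_le_mul_of_nonneg_left h1 (sq_nonneg h)
  set I := ⟪gradient g y, y - c⟫
  set D := ‖y - c‖
  -- Short steps are nonexpansive by cocoercivity; long ones expand by at most `h L - 1 ≤ K`,
  -- because `⟪∇g(y), y - c⟫ ≤ L ‖y - c‖²`.
  rcases le_total (h * L) 2 with h6 | h6
  · have : h * (h * L) * I ≤ h * 2 * I := by gcongr
    nlinarith [mul_nonneg (sub_nonneg.2 hK) (sq_nonneg D),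
      mul_nonneg (sub_nonneg.2 hK) (mul_nonneg (zero_le_one.trans hK) (sq_nonneg D))]
  · have h7 : h * (h * L - 2) * I ≤ h * (h * L - 2) * (L * D * D) := by
      gcongr
    have h8 : (h * L - 1) ^ 2 * D ^ 2 ≤ K ^ 2 * D ^ 2 := by
      gcongr
      · linarith
      · linarith
    nlinarith

end SingleFunction

/-! ### One exact AGD step for a single function. -/

section SingleFunctionAGD

variable {n : ℕ} {L μ : ℝ} {g : Vec n → ℝ} {c : Vec n}

lemma momentum_mem_Icc (k : ℝ) : √k / (√k + 1) ∈ Set.Icc (0 : ℝ) 1 :=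
  ⟨by positivity, by rw [div_le_one (by positivity)]; linarith⟩

lemma one_sub_one_div_sqrt_mem_Icc {k : ℝ} (hk : 1 ≤ k) : 1 - 1 / √k ∈ Set.Icc (0 : ℝ) 1 := by
  have h1 : 1 ≤ √k := Real.one_le_sqrt.2 hk
  have h2 : 1 / √k ≤ 1 := by rw [div_le_one (by positivity)]; exact h1
  have h3 : 0 ≤ 1 / √k := by positivity
  constructor <;> linarith

lemma convexComb_value_le (hc : ConvexOn ℝ Set.univ g) {a A : ℝ} (ha : a ∈ Set.Icc (0 : ℝ) 1)
    {x v : Vec n} (hx : g x ≤ A) (hv : g v ≤ A) : g (a • x + (1 - a) • v) ≤ A := by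
  have h := hc.2 (Set.mem_univ x) (Set.mem_univ v) ha.1 (sub_nonneg.2 ha.2)
    (add_sub_cancel a 1)
  simp only [smul_eq_mul] at h
  nlinarith [ha.1, ha.2]

lemma convexComb_norm_sub_le {a A : ℝ} (ha : a ∈ Set.Icc (0 : ℝ) 1)
    {x v : Vec n} (hx : ‖x - c‖ ≤ A) (hv : ‖v - c‖ ≤ A) : ‖a • x + (1 - a) • v - c‖ ≤ A := by
  have := (convex_closedBall c A) (x := x) (y := v) (by simpa [dist_eq_norm] using hx)
    (by simpa [dist_eq_norm] using hv) ha.1 (sub_nonneg.2 ha.2) (add_sub_cancel a 1)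
  simpa [dist_eq_norm] using this

/-- The gradient steps, of lengths `1/L'` and `1/μ'`, are at most `2/L` long and do not increase
`g`; the rest of AGD consists of convex combinations. The slack of two in `hL` is what tolerates
guessed parameters. -/
lemma exactAGD_value_le (hg : IsSmooth L g) (hc : ConvexOn ℝ Set.univ g) {L' μ' A : ℝ}
    (hμ : 0 < μ') (hμL : μ' ≤ L') (hL : L ≤ 2 * μ') {x v : Vec n} (hx : g x ≤ A)
    (hv : g v ≤ A) :
    g (exactAGD g x v L' μ').1 ≤ A ∧ g (exactAGD g x v L' μ').2 ≤ A := by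
  have hy := convexComb_value_le hc (momentum_mem_Icc (L' / μ')) hx hv
  have hβ := one_sub_one_div_sqrt_mem_Icc ((one_le_div hμ).2 hμL)
  have hL' : 0 < L' := hμ.trans_le hμL
  refine ⟨(hg.step_le_self (by positivity) ?_ _).trans hy,
    convexComb_value_le hc hβ hv ((hg.step_le_self (by positivity) ?_ _).trans hy)⟩
  · rw [one_div, inv_mul_le_iff₀ hL']; linarith
  · rw [one_div, inv_mul_le_iff₀ hμ]; linarith

lemma exactAGD_norm_sub_le (hg : IsSmooth L g) (hL0 : 0 < L) (hμ0 : 0 ≤ μ)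
    (hc : StrongConvexOn Set.univ μ g) (hmin : ∀ x, g c ≤ g x) {L' μ' A K : ℝ}
    (hμ : 0 < μ') (hμL : μ' ≤ L') (hK : 1 ≤ K) (hL : L ≤ (K + 1) * μ') {x v : Vec n}
    (hx : ‖x - c‖ ≤ A) (hv : ‖v - c‖ ≤ A) :
    ‖(exactAGD g x v L' μ').1 - c‖ ≤ K * A ∧ ‖(exactAGD g x v L' μ').2 - c‖ ≤ K * A := by
  have hy := convexComb_norm_sub_le (momentum_mem_Icc (L' / μ')) hx hv
  have hβ := one_sub_one_div_sqrt_mem_Icc ((one_le_div hμ).2 hμL)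
  have hL' : 0 < L' := hμ.trans_le hμL
  have hA : 0 ≤ A := (norm_nonneg _).trans hx
  have hKy := mul_le_mul_of_nonneg_left hy (zero_le_one.trans hK)
  have hAK : A ≤ K * A := le_mul_of_one_le_left hA hK
  refine ⟨(hg.norm_step_sub_le hL0 hμ0 hc hmin (by positivity) hK ?_ _).trans hKy,
    convexComb_norm_sub_le hβ (hv.trans hAK)
      ((hg.norm_step_sub_le hL0 hμ0 hc hmin (by positivity) hK ?_ _).trans hKy)⟩
  · rw [one_div, inv_mul_le_iff₀ hL']; nlinarith
  · rw [one_div, inv_mul_le_iff₀ hμ]; linarith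

/-- With `s = √(L/μ)`, `v₊ - c` is a convex combination `b` of `v - c` and `y - c`, minus `G/(sμ)`.
The term quadratic in `G` is paid exactly by the descent of the gradient step, the linear ones by
strong convexity at `y`, towards `c` with weight `1/s` and towards `x` with weight `1 - 1/s`. -/
lemma exactAGD_contracts (hg : IsSmooth L g) (hμ : 0 < μ) (hμL : μ ≤ L)
    (hc : StrongConvexOn Set.univ μ g) (x v : Vec n) :
    g (exactAGD g x v L μ).1 - g c + μ / 2 * ‖(exactAGD g x v L μ).2 - c‖ ^ 2 ≤
      (1 - 1 / √(L / μ)) * (g x - g c + μ / 2 * ‖v - c‖ ^ 2) := by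
  have hL : 0 < L := hμ.trans_le hμL
  have hβ := one_sub_one_div_sqrt_mem_Icc ((one_le_div hμ).2 hμL)
  have hk : 0 < √(L / μ) := by positivity
  have hk2 : √(L / μ) ^ 2 = L / μ := Real.sq_sqrt (by positivity)
  simp only [exactAGD]
  set s := √(L / μ)
  set y := (s / (s + 1)) • x + (1 - s / (s + 1)) • v with hy
  set G := gradient g y
  have hvy : v - y = s • (y - x) := by
    rw [hy]
    have e : s / (s + 1) = s * (1 - s / (s + 1)) := by field_simp; ring
    have e' : (s : ℝ) - s * (s / (s + 1)) = s / (s + 1) := by field_simp; ring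
    have : v - ((s / (s + 1)) • x + (1 - s / (s + 1)) • v) -
        s • (((s / (s + 1)) • x + (1 - s / (s + 1)) • v) - x) =
        (1 - (1 - s / (s + 1)) - s * (1 - s / (s + 1))) • v +
          (s - s * (s / (s + 1)) - s / (s + 1)) • x := by module
    rw [← sub_eq_zero, this, ← e, e']
    simp
  set b := (1 - 1 / s) • (v - c) + (1 / s) • (y - c) with hb
  have hb' : b = (y - c) + (s - 1) • (y - x) := by
    have : b = (y - c) + (1 - 1 / s) • (v - y) := by rw [hb]; module
    rw [this, hvy, smul_smul]
    congr 2
    field_simp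
  have hvp : (1 - 1 / s) • v + (1 - (1 - 1 / s)) • (y - (1 / μ) • G) - c =
      b - (1 / (s * μ)) • G := by
    have : (1 / (s * μ)) = (1 / s) * (1 / μ) := by field_simp
    rw [hb, this]
    module
  have hbn : ‖b‖ ^ 2 ≤ (1 - 1 / s) * ‖v - c‖ ^ 2 + (1 / s) * ‖y - c‖ ^ 2 := by
    have e : (1 - 1 / s) * ‖v - c‖ ^ 2 + (1 / s) * ‖y - c‖ ^ 2 - ‖b‖ ^ 2 =
        (1 - 1 / s) * (1 / s) * ‖(v - c) - (y - c)‖ ^ 2 := by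
      rw [hb, norm_add_sq_real, norm_sub_sq_real (v - c) (y - c), norm_smul, norm_smul, mul_pow, mul_pow,
        Real.norm_eq_abs, Real.norm_eq_abs, sq_abs, sq_abs, real_inner_smul_left,
        real_inner_smul_right]
      ring
    have : 0 ≤ (1 - 1 / s) * (1 / s) * ‖(v - c) - (y - c)‖ ^ 2 :=
      mul_nonneg (mul_nonneg hβ.1 (by positivity)) (sq_nonneg _)
    linarith
  have hstep := hg.step_le (1 / L) y
  have e1 : 1 / L - L / 2 * (1 / L) ^ 2 = 1 / (2 * L) := by field_simp; ring
  rw [e1] at hstep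
  have hsc1 := hc.quadratic_le hg.1 y (c - y)
  have hsc2 := hc.quadratic_le hg.1 y (x - y)
  rw [add_sub_cancel, ← neg_sub y c, norm_neg, inner_neg_right] at hsc1
  rw [add_sub_cancel, ← neg_sub y x, norm_neg, inner_neg_right] at hsc2
  rw [hvp, norm_sub_sq_real, inner_smul_right, norm_smul, mul_pow, Real.norm_eq_abs, sq_abs]
  have hin : ⟪b, G⟫ = ⟪G, y - c⟫ + (s - 1) * ⟪G, y - x⟫ := by
    rw [real_inner_comm, hb', inner_add_right, inner_smul_right]
  rw [hin]
  have e2 : μ / 2 * ((1 / (s * μ)) ^ 2 * ‖G‖ ^ 2) = 1 / (2 * L) * ‖G‖ ^ 2 := by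
    have : s ^ 2 * μ = L := by rw [hk2]; field_simp
    rw [← this]; field_simp
  have e3 : μ / 2 * (2 * (1 / (s * μ) * (⟪G, y - c⟫ + (s - 1) * ⟪G, y - x⟫))) =
      1 / s * ⟪G, y - c⟫ + (1 - 1 / s) * ⟪G, y - x⟫ := by
    field_simp
  have h1 := mul_le_mul_of_nonneg_left hsc1 (by positivity : 0 ≤ 1 / s)
  have h2 := mul_le_mul_of_nonneg_left hsc2 hβ.1
  have h3 := mul_le_mul_of_nonneg_left hbn (by positivity : 0 ≤ μ / 2)
  have h4 : 0 ≤ (1 - 1 / s) * (μ / 2 * ‖y - x‖ ^ 2) := mul_nonneg hβ.1 (by positivity)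
  linarith

end SingleFunctionAGD

/-! ### Decomposition of the problem into blocks. -/

namespace MultiscaleProblem

variable {d m : ℕ} (Q : MultiscaleProblem d m)

/-- The product `Pᵢᵀ u`. -/
def blockT (i : Fin m) (u : Vec (Q.dim i)) : Vec d :=
  WithLp.toLp 2 ((Q.proj i).transpose.mulVec u.ofLp)

lemma block_add (i : Fin m) (x y : Vec d) : Q.block i (x + y) = Q.block i x + Q.block i y := by
  simp [block, Matrix.mulVec_add]

lemma block_sub (i : Fin m) (x y : Vec d) : Q.block i (x - y) = Q.block i x - Q.block i y := by
  simp [block, Matrix.mulVec_sub]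

lemma block_smul (i : Fin m) (a : ℝ) (x : Vec d) : Q.block i (a • x) = a • Q.block i x := by
  simp [block, Matrix.mulVec_smul]

lemma inner_block (i : Fin m) (x : Vec d) (u : Vec (Q.dim i)) :
    ⟪Q.block i x, u⟫ = ⟪x, Q.blockT i u⟫ := by
  simp only [block, blockT, EuclideanSpace.inner_eq_star_dotProduct, star_trivial]
  rw [Matrix.mulVec_transpose, Matrix.dotProduct_mulVec]

lemma block_blockT_self (i : Fin m) (u : Vec (Q.dim i)) : Q.block i (Q.blockT i u) = u := by
  simp [block, blockT, Matrix.mulVec_mulVec, Q.proj_self]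

lemma block_blockT_of_ne {i j : Fin m} (h : i ≠ j) (u : Vec (Q.dim j)) :
    Q.block i (Q.blockT j u) = 0 := by
  simp [block, blockT, Matrix.mulVec_mulVec, Q.proj_orth i j h]

/-- All the projections stacked into one square matrix. -/
def stacked : Matrix (Σ i, Fin (Q.dim i)) (Fin d) ℝ := fun p k => Q.proj p.1 p.2 k

lemma stacked_mul_transpose : Q.stacked * Q.stacked.transpose = 1 := by
  ext ⟨i, a⟩ ⟨j, b⟩
  have h : (Q.stacked * Q.stacked.transpose) ⟨i, a⟩ ⟨j, b⟩ =
      (Q.proj i * (Q.proj j).transpose) a b := rfl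
  rw [h]
  rcases eq_or_ne i j with rfl | hij
  · rw [Q.proj_self]
    simp [Matrix.one_apply]
  · rw [Q.proj_orth i j hij, Matrix.one_apply_ne (by simp [hij])]
    rfl

/-- Here `sum_dim` enters: the stacked matrix is square, so its right inverse is two-sided. This
yields Pythagoras for the blocks. -/
lemma stacked_transpose_mul : Q.stacked.transpose * Q.stacked = 1 := by
  have hc : Fintype.card (Σ i, Fin (Q.dim i)) = Fintype.card (Fin d) := by
    simp [Q.sum_dim]
  exact (Matrix.mul_eq_one_comm_of_equiv (Fintype.equivOfCardEq hc)).1 Q.stacked_mul_transpose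

lemma sum_norm_block_sq (x : Vec d) : ∑ i, ‖Q.block i x‖ ^ 2 = ‖x‖ ^ 2 := by
  have h1 : ∑ i, ‖Q.block i x‖ ^ 2 =
      (Q.stacked.mulVec x.ofLp) ⬝ᵥ (Q.stacked.mulVec x.ofLp) := by
    simp only [EuclideanSpace.real_norm_sq_eq, dotProduct, Fintype.sum_sigma, ← sq]
    rfl
  rw [h1, Matrix.dotProduct_mulVec, Matrix.vecMul_mulVec, ← Matrix.mulVec_transpose]
  simp [Q.stacked_transpose_mul, dotProduct, EuclideanSpace.real_norm_sq_eq, ← sq]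

lemma norm_block_le (i : Fin m) (x : Vec d) : ‖Q.block i x‖ ≤ ‖x‖ := by
  apply abs_le_of_sq_le_sq' _ (norm_nonneg x) |>.2
  rw [← Q.sum_norm_block_sq]
  exact Finset.single_le_sum (f := fun i => ‖Q.block i x‖ ^ 2) (fun i _ => sq_nonneg _)
    (Finset.mem_univ i)

lemma norm_le_of_block_le {x : Vec d} {A : ℝ} (hA : ∀ i, ‖Q.block i x‖ ≤ A) (hA0 : 0 ≤ A) :
    ‖x‖ ≤ √m * A := by
  apply abs_le_of_sq_le_sq' _ (by positivity) |>.2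
  rw [← Q.sum_norm_block_sq, mul_pow, Real.sq_sqrt (Nat.cast_nonneg m)]
  calc ∑ i, ‖Q.block i x‖ ^ 2 ≤ ∑ _i : Fin m, A ^ 2 :=
        Finset.sum_le_sum fun i _ => pow_le_pow_left₀ (norm_nonneg _) (hA i) 2
    _ = m * A ^ 2 := by simp

/-- The projection as a continuous linear map. -/
noncomputable def blockL (i : Fin m) : Vec d →L[ℝ] Vec (Q.dim i) :=
  LinearMap.toContinuousLinearMap
    { toFun := Q.block i, map_add' := Q.block_add i, map_smul' := Q.block_smul i }

lemma blockL_apply (i : Fin m) (x : Vec d) : Q.blockL i x = Q.block i x := rfl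

lemma inner_gradient_obj (y u : Vec d) :
    ⟪gradient Q.obj y, u⟫ = ∑ i, ⟪gradient (Q.sub i) (Q.block i y), Q.block i u⟫ := by
  have h : HasFDerivAt Q.obj
      (∑ i, (fderiv ℝ (Q.sub i) (Q.block i y)).comp (Q.blockL i)) y := by
    have : Q.obj = ∑ i, fun x => Q.sub i (Q.block i x) := by
      ext x; simp [obj]
    rw [this]
    apply HasFDerivAt.sum
    intro i _
    exact ((Q.smooth i).1 (Q.block i y)).hasFDerivAt.comp y (Q.blockL i).hasFDerivAt
  rw [inner_gradient_eq_fderiv, h.fderiv]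
  simp [blockL_apply]

lemma block_gradient_obj (i : Fin m) (y : Vec d) :
    Q.block i (gradient Q.obj y) = gradient (Q.sub i) (Q.block i y) := by
  apply ext_inner_right ℝ
  intro u
  rw [inner_block, inner_gradient_obj, Finset.sum_eq_single i]
  · rw [block_blockT_self]
  · intro j _ hj
    rw [block_blockT_of_ne _ hj, inner_zero_right]
  · simp

lemma block_exactAGD_fst (i : Fin m) (x v : Vec d) (L μ : ℝ) :
    Q.block i (exactAGD Q.obj x v L μ).1 =
      (exactAGD (Q.sub i) (Q.block i x) (Q.block i v) L μ).1 := by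
  simp [exactAGD, block_add, block_sub, block_smul, block_gradient_obj]

lemma block_exactAGD_snd (i : Fin m) (x v : Vec d) (L μ : ℝ) :
    Q.block i (exactAGD Q.obj x v L μ).2 =
      (exactAGD (Q.sub i) (Q.block i x) (Q.block i v) L μ).2 := by
  simp [exactAGD, block_add, block_sub, block_smul, block_gradient_obj]

variable {xstar : Vec d}

/-- Moving `xstar` within the range of `Pᵢᵀ` changes only block `i`, so minimality of the sum passes
to each summand. -/
lemma sub_block_min (hmin : IsMinOn Q.obj Set.univ xstar) (i : Fin m) (u : Vec (Q.dim i)) :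
    Q.sub i (Q.block i xstar) ≤ Q.sub i u := by
  have h : Q.obj xstar ≤ Q.obj (xstar + Q.blockT i (u - Q.block i xstar)) :=
    hmin (Set.mem_univ _)
  simp only [obj] at h
  rw [← Finset.add_sum_erase _ _ (Finset.mem_univ i),
    ← Finset.add_sum_erase _ _ (Finset.mem_univ i), block_add, block_blockT_self,
    add_sub_cancel] at h
  have e : ∑ j ∈ Finset.univ.erase i, Q.sub j (Q.block j xstar) =
      ∑ j ∈ Finset.univ.erase i,
        Q.sub j (Q.block j (xstar + Q.blockT i (u - Q.block i xstar))) := by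
    apply Finset.sum_congr rfl
    intro j hj
    rw [block_add, block_blockT_of_ne _ (Finset.ne_of_mem_erase hj), add_zero]
  linarith

lemma err_eq (hmin : IsMinOn Q.obj Set.univ xstar) (i : Fin m) (x : Vec d) :
    Q.err i x = Q.sub i (Q.block i x) - Q.sub i (Q.block i xstar) := by
  rw [err]
  congr 1
  apply le_antisymm
  · exact ciInf_le ⟨_, Set.forall_mem_range.2 (Q.sub_block_min hmin i)⟩ _
  · exact le_ciInf (Q.sub_block_min hmin i)

lemma err_nonneg (hmin : IsMinOn Q.obj Set.univ xstar) (i : Fin m) (x : Vec d) :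
    0 ≤ Q.err i x := by
  rw [Q.err_eq hmin]
  exact sub_nonneg.2 (Q.sub_block_min hmin i _)

lemma sum_err (hmin : IsMinOn Q.obj Set.univ xstar) (x : Vec d) :
    ∑ i, Q.err i x = Q.obj x - Q.obj xstar := by
  simp [Q.err_eq hmin, obj]

lemma L_pos (i : Fin m) : 0 < Q.L i := (Q.μ_pos i).trans_le (Q.μ_le_L i)

/-- The distance of the `i`-th block to that of the minimizer. -/
noncomputable def gap (xstar : Vec d) (i : Fin m) (x : Vec d) : ℝ := ‖Q.block i (x - xstar)‖

lemma gap_nonneg (i : Fin m) (x : Vec d) : 0 ≤ Q.gap xstar i x := norm_nonneg _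

lemma gap_eq (i : Fin m) (x : Vec d) : Q.gap xstar i x = ‖Q.block i x - Q.block i xstar‖ := by
  rw [gap, block_sub]

lemma mul_gap_sq_le_err (hmin : IsMinOn Q.obj Set.univ xstar) (i : Fin m) (x : Vec d) :
    Q.μ i / 2 * Q.gap xstar i x ^ 2 ≤ Q.err i x := by
  rw [Q.err_eq hmin, gap_eq]
  exact (Q.strong_convex i).le_sub_min (Q.smooth i).1 (Q.sub_block_min hmin i) _

lemma err_le_mul_gap_sq (hmin : IsMinOn Q.obj Set.univ xstar) (i : Fin m) (x : Vec d) :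
    Q.err i x ≤ Q.L i / 2 * Q.gap xstar i x ^ 2 := by
  rw [Q.err_eq hmin, gap_eq]
  exact (Q.smooth i).sub_min_le (Q.sub_block_min hmin i) _

lemma gap_le_add (i : Fin m) (x x' : Vec d) :
    Q.gap xstar i x' ≤ Q.gap xstar i x + ‖x' - x‖ := by
  rw [gap_eq, gap_eq]
  calc ‖Q.block i x' - Q.block i xstar‖
      = ‖(Q.block i x - Q.block i xstar) + Q.block i (x' - x)‖ := by rw [block_sub]; congr 1; abel
    _ ≤ _ := (norm_add_le _ _).trans (by gcongr; exact Q.norm_block_le i _)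

lemma sqrt_err_le_add (hmin : IsMinOn Q.obj Set.univ xstar) (i : Fin m) (x x' : Vec d) :
    √(Q.err i x') ≤ √(Q.err i x) + √(Q.L i / 2) * ‖x' - x‖ := by
  rw [Q.err_eq hmin, Q.err_eq hmin]
  have h := (Q.smooth i).sqrt_sub_min_le (Q.L_pos i) (Q.sub_block_min hmin i) (Q.block i x)
    (Q.block i (x' - x))
  rw [← block_add, add_sub_cancel] at h
  refine h.trans ?_
  gcongr
  exact Q.norm_block_le i _

end MultiscaleProblem

/-! ### One inexact AGD step seen on each block. -/

namespace MultiscaleProblem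

variable {d m : ℕ} (Q : MultiscaleProblem d m)

/-- Parameters for AGD that lie in `[lo, hi]`, are valid for each scale, and separate the scales
up to a factor of two. -/
structure Admissible (L μ : Fin m → ℝ) (lo hi : ℝ) : Prop where
  lo_pos : 0 < lo
  lo_le : ∀ i, lo ≤ μ i
  le_μ : ∀ i, μ i ≤ Q.μ i
  le_L : ∀ i, Q.L i ≤ L i
  le_hi : ∀ i, L i ≤ hi
  L_le : ∀ i j, i < j → L i ≤ 2 * μ j

/-- The contribution of the `i`-th block to the potential, with parameters `μ`. -/
noncomputable def pot (xstar : Vec d) (μ : Fin m → ℝ) (i : Fin m) (z : Vec d × Vec d) : ℝ :=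
  Q.err i z.1 + μ i / 2 * Q.gap xstar i z.2 ^ 2

/-- The factor by which one round at scale `i` reduces the square root of the potential. -/
noncomputable def rate (L μ : Fin m → ℝ) (i : Fin m) : ℝ := Real.exp (-(1 / (2 * √(L i / μ i))))

lemma rate_pos (L μ : Fin m → ℝ) (i : Fin m) : 0 < rate L μ i := Real.exp_pos _

lemma rate_le_one (L μ : Fin m → ℝ) (i : Fin m) : rate L μ i ≤ 1 :=
  Real.exp_le_one_iff.2 (neg_nonpos.2 (by positivity))

namespace Admissible

variable {Q} {L μ : Fin m → ℝ} {lo hi : ℝ} (hA : Q.Admissible L μ lo hi)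
include hA

lemma μ_pos (i : Fin m) : 0 < μ i := hA.lo_pos.trans_le (hA.lo_le i)

lemma μ_le_L (i : Fin m) : μ i ≤ L i := (hA.le_μ i).trans ((Q.μ_le_L i).trans (hA.le_L i))

lemma L_pos (i : Fin m) : 0 < L i := (hA.μ_pos i).trans_le (hA.μ_le_L i)

lemma one_le_cond (i : Fin m) : 1 ≤ hi / lo :=
  (one_le_div hA.lo_pos).2 ((hA.lo_le i).trans ((hA.μ_le_L i).trans (hA.le_hi i)))

lemma L_le_mul (i j : Fin m) : L i ≤ hi / lo * μ j := by
  have h1 : 0 ≤ hi / lo := zero_le_one.trans (hA.one_le_cond i)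
  calc L i ≤ hi := hA.le_hi i
    _ = hi / lo * lo := by rw [div_mul_cancel₀ _ hA.lo_pos.ne']
    _ ≤ hi / lo * μ j := by gcongr; exact hA.lo_le j

lemma smooth (i : Fin m) : IsSmooth (L i) (Q.sub i) :=
  ⟨(Q.smooth i).1, fun x y => ((Q.smooth i).2 x y).trans (by gcongr; exact hA.le_L i)⟩

lemma strong_convex (i : Fin m) : StrongConvexOn Set.univ (μ i) (Q.sub i) :=
  (Q.strong_convex i).mono (hA.le_μ i)

lemma exp_neg_half_le_rate (i : Fin m) : Real.exp (-(1 / 2)) ≤ rate L μ i := by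
  have h : 1 ≤ √(L i / μ i) := Real.one_le_sqrt.2 ((one_le_div (hA.μ_pos i)).2 (hA.μ_le_L i))
  apply Real.exp_le_exp.2
  rw [neg_le_neg_iff]
  apply one_div_le_one_div_of_le <;> linarith

variable {xstar : Vec d} (hmin : IsMinOn Q.obj Set.univ xstar)
include hmin

lemma pot_nonneg (i : Fin m) (z : Vec d × Vec d) : 0 ≤ Q.pot xstar μ i z :=
  add_nonneg (Q.err_nonneg hmin i _) (by have := hA.μ_pos i; positivity)

lemma mul_gap_sq_le_err (i : Fin m) (x : Vec d) : μ i / 2 * Q.gap xstar i x ^ 2 ≤ Q.err i x := by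
  refine le_trans ?_ (Q.mul_gap_sq_le_err hmin i x)
  gcongr
  exact hA.le_μ i

lemma err_le_mul_gap_sq (i : Fin m) (x : Vec d) : Q.err i x ≤ L i / 2 * Q.gap xstar i x ^ 2 := by
  refine (Q.err_le_mul_gap_sq hmin i x).trans ?_
  gcongr
  exact hA.le_L i

lemma sqrt_err_le_add (i : Fin m) (x x' : Vec d) :
    √(Q.err i x') ≤ √(Q.err i x) + √(L i / 2) * ‖x' - x‖ := by
  refine (Q.sqrt_err_le_add hmin i x x').trans ?_
  gcongr
  exact hA.le_L i

lemma gap_le_of_sqrt_pot_le {i : Fin m} {z : Vec d × Vec d} {P : ℝ}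
    (hP : √(Q.pot xstar μ i z) ≤ P) :
    Q.gap xstar i z.1 ≤ √(2 / μ i) * P ∧ Q.gap xstar i z.2 ≤ √(2 / μ i) * P := by
  have hμ := hA.μ_pos i
  have hP0 : 0 ≤ P := (Real.sqrt_nonneg _).trans hP
  have h1 : Q.pot xstar μ i z ≤ P ^ 2 := (Real.sqrt_le_left hP0).1 hP
  have h2 := hA.mul_gap_sq_le_err hmin i z.1
  have h3 := Q.err_nonneg hmin i z.1
  have h4 : 0 ≤ μ i / 2 * Q.gap xstar i z.2 ^ 2 := by positivity
  rw [pot] at h1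
  constructor <;>
  · apply abs_le_of_sq_le_sq' _ (by positivity) |>.2
    rw [mul_pow, Real.sq_sqrt (by positivity), div_mul_eq_mul_div, le_div_iff₀ hμ]
    linarith

lemma sqrt_pot_le_of_gap_le {i : Fin m} {z : Vec d × Vec d} {σ : ℝ} (h1 : Q.gap xstar i z.1 ≤ σ)
    (h2 : Q.gap xstar i z.2 ≤ σ) : √(Q.pot xstar μ i z) ≤ √(L i) * σ := by
  have hσ : 0 ≤ σ := (Q.gap_nonneg i _).trans h1
  apply Real.sqrt_le_iff.2 ⟨by positivity, ?_⟩
  rw [mul_pow, Real.sq_sqrt (hA.L_pos i).le, pot]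
  have h3 := hA.err_le_mul_gap_sq hmin i z.1
  have h4 : L i / 2 * Q.gap xstar i z.1 ^ 2 ≤ L i / 2 * σ ^ 2 := by
    have := hA.L_pos i
    have := Q.gap_nonneg (xstar := xstar) i z.1
    gcongr
  have h5 : μ i / 2 * Q.gap xstar i z.2 ^ 2 ≤ L i / 2 * σ ^ 2 := by
    have := hA.L_pos i
    have := Q.gap_nonneg (xstar := xstar) i z.2
    have := hA.μ_le_L i
    gcongr
  linarith

/-- By Cauchy–Schwarz and `μ i ≤ L i`, the cross terms of the two perturbations are at most `2 √pot
√(L i) e`. The components have separate hypotheses because in a round they come from different inner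
calls. -/
lemma sqrt_pot_le_add {i : Fin m} {z z' : Vec d × Vec d} {e : ℝ} (he : 0 ≤ e)
    (h1 : √(Q.err i z'.1) ≤ √(Q.err i z.1) + √(L i / 2) * e)
    (h2 : Q.gap xstar i z'.2 ≤ Q.gap xstar i z.2 + e) :
    √(Q.pot xstar μ i z') ≤ √(Q.pot xstar μ i z) + √(L i) * e := by
  have hμ := hA.μ_pos i
  have hL := hA.L_pos i
  have hμL := hA.μ_le_L i
  have hg := Q.gap_nonneg (xstar := xstar) i z.2
  have hg' := Q.gap_nonneg (xstar := xstar) i z'.2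
  have hE := Q.err_nonneg hmin i z.1
  have hP := hA.pot_nonneg hmin i z
  apply Real.sqrt_le_iff.2 ⟨by positivity, ?_⟩
  have h3 : Q.err i z'.1 ≤ (√(Q.err i z.1) + √(L i / 2) * e) ^ 2 :=
    (Real.sqrt_le_left (by positivity)).1 h1
  have h4 : Q.gap xstar i z'.2 ^ 2 ≤ (Q.gap xstar i z.2 + e) ^ 2 := by gcongr
  have h5 : √(Q.err i z.1) * √(L i / 2) + μ i / 2 * Q.gap xstar i z.2 ≤
      √(Q.pot xstar μ i z) * √(L i) := by
    rw [← Real.sqrt_mul hP]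
    apply Real.le_sqrt_of_sq_le
    -- The square in Lagrange's identity for the vectors `(√err, √(μ/2) gap)` and `(√(L/2),
    -- √(μ/2))`.
    have h6 : 0 ≤ (√(Q.err i z.1) * √(μ i / 2) -
        √(L i / 2) * (√(μ i / 2) * Q.gap xstar i z.2)) ^ 2 :=
      sq_nonneg _
    have a1 := Real.sq_sqrt hE
    have a2 := Real.sq_sqrt (half_pos hL).le
    have a3 := Real.sq_sqrt (half_pos hμ).le
    rw [sub_sq, mul_pow, mul_pow, mul_pow, a1, a2, a3] at h6
    rw [add_sq, mul_pow, mul_pow, a1, a2, pot]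
    have h7 : 2 * (√(Q.err i z.1) * √(μ i / 2)) * (√(L i / 2) * (√(μ i / 2) * Q.gap xstar i z.2)) =
        2 * (√(Q.err i z.1) * √(L i / 2)) * (μ i / 2 * Q.gap xstar i z.2) := by
      linear_combination 2 * √(Q.err i z.1) * √(L i / 2) * Q.gap xstar i z.2 * a3
    rw [h7] at h6
    have h8 : 0 ≤ (L i - μ i) * Q.err i z.1 := mul_nonneg (by linarith) hE
    have h9 : 0 ≤ (L i - μ i) * (μ i * Q.gap xstar i z.2 ^ 2) :=
      mul_nonneg (by linarith) (by positivity)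
    nlinarith
  have h10 : μ i / 2 * Q.gap xstar i z'.2 ^ 2 ≤ μ i / 2 * (Q.gap xstar i z.2 + e) ^ 2 := by gcongr
  have h11 := mul_le_mul_of_nonneg_right h5 he
  have h12 : (L i / 2 + μ i / 2) * e ^ 2 ≤ L i * e ^ 2 := by gcongr; linarith
  rw [add_sq, Real.sq_sqrt hP, mul_pow, Real.sq_sqrt hL.le]
  rw [add_sq, Real.sq_sqrt hE, mul_pow, Real.sq_sqrt (half_pos hL).le] at h3
  simp only [pot] at *
  nlinarith

omit hA in
lemma _root_.MultiscaleProblem.err_le_iff (i : Fin m) (x : Vec d) {A : ℝ} (hA0 : 0 ≤ A) :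
    √(Q.err i x) ≤ A ↔ Q.sub i (Q.block i x) ≤ Q.sub i (Q.block i xstar) + A ^ 2 := by
  rw [Real.sqrt_le_left hA0, Q.err_eq hmin]
  constructor <;> intro h <;> linarith

variable {x v : Vec d} {i : Fin m} {w : Vec d × Vec d} {η : ℝ}
  (hw1 : ‖w.1 - (exactAGD Q.obj x v (L i) (μ i)).1‖ ≤ η)
  (hw2 : ‖w.2 - (exactAGD Q.obj x v (L i) (μ i)).2‖ ≤ η)
include hw1 hw2

lemma step_err {j : Fin m} (hij : j < i) {A : ℝ} (hx : √(Q.err j x) ≤ A)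
    (hv : √(Q.err j v) ≤ A) :
    √(Q.err j w.1) ≤ A + √(L j / 2) * η ∧ √(Q.err j w.2) ≤ A + √(L j / 2) * η := by
  have hA0 : 0 ≤ A := (Real.sqrt_nonneg _).trans hx
  rw [Q.err_le_iff hmin _ _ hA0] at hx hv
  have hc : ConvexOn ℝ Set.univ (Q.sub j) :=
    (hA.strong_convex j).convexOn fun r => by have := hA.μ_pos j; positivity
  have h := exactAGD_value_le (hA.smooth j) hc (hA.μ_pos i) (hA.μ_le_L i) (hA.L_le j i hij) hx hv
  rw [← block_exactAGD_fst, ← block_exactAGD_snd, ← Q.err_le_iff hmin _ _ hA0,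
    ← Q.err_le_iff hmin _ _ hA0] at h
  exact ⟨(hA.sqrt_err_le_add hmin j _ _).trans (by gcongr; exact h.1),
    (hA.sqrt_err_le_add hmin j _ _).trans (by gcongr; exact h.2)⟩

lemma step_gap {j : Fin m} {A K : ℝ} (hK : 1 ≤ K) (hL : L j ≤ (K + 1) * μ i)
    (hx : Q.gap xstar j x ≤ A) (hv : Q.gap xstar j v ≤ A) :
    Q.gap xstar j w.1 ≤ K * A + η ∧ Q.gap xstar j w.2 ≤ K * A + η := by
  rw [gap_eq] at hx hv
  have h := exactAGD_norm_sub_le (hA.smooth j) (hA.L_pos j) (hA.μ_pos j).le (hA.strong_convex j)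
    (Q.sub_block_min hmin j) (hA.μ_pos i) (hA.μ_le_L i) hK hL hx hv
  rw [← block_exactAGD_fst, ← block_exactAGD_snd, ← gap_eq, ← gap_eq] at h
  exact ⟨(Q.gap_le_add j _ _).trans (add_le_add h.1 hw1),
    (Q.gap_le_add j _ _).trans (add_le_add h.2 hw2)⟩

lemma step_gap_low {j : Fin m} {A : ℝ} (hij : j < i)
    (hx : Q.gap xstar j x ≤ A) (hv : Q.gap xstar j v ≤ A) :
    Q.gap xstar j w.1 ≤ A + η ∧ Q.gap xstar j w.2 ≤ A + η := by
  simpa using hA.step_gap hmin hw1 hw2 le_rfl (by linarith [hA.L_le j i hij]) hx hv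

lemma step_gap_any {j : Fin m} {A : ℝ} (hx : Q.gap xstar j x ≤ A) (hv : Q.gap xstar j v ≤ A) :
    Q.gap xstar j w.1 ≤ hi / lo * A + η ∧ Q.gap xstar j w.2 ≤ hi / lo * A + η :=
  hA.step_gap hmin hw1 hw2 (hA.one_le_cond j)
    (by linarith [hA.L_le_mul j i, hA.μ_pos i]) hx hv

/-- The potential contracts by `1 - 1/√κᵢ ≤ exp (-1/√κᵢ)`, whose square root is `rate`;
`sqrt_pot_le_add` adds the error of the step. -/
lemma step_pot : √(Q.pot xstar μ i w) ≤ rate L μ i * √(Q.pot xstar μ i (x, v)) + √(L i) * η := by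
  refine (hA.sqrt_pot_le_add hmin (z := exactAGD Q.obj x v (L i) (μ i)) ((norm_nonneg _).trans hw1)
    ((hA.sqrt_err_le_add hmin i _ _).trans (by gcongr))
    ((Q.gap_le_add i _ _).trans (by gcongr))).trans ?_
  gcongr
  have h := exactAGD_contracts (hA.smooth i) (hA.μ_pos i) (hA.μ_le_L i) (hA.strong_convex i)
    (c := Q.block i xstar) (Q.block i x) (Q.block i v)
  rw [← block_exactAGD_fst, ← block_exactAGD_snd, ← gap_eq, ← gap_eq, ← Q.err_eq hmin,
    ← Q.err_eq hmin] at h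
  have hP := hA.pot_nonneg hmin i (x, v)
  have hr := rate_pos L μ i
  apply Real.sqrt_le_iff.2 ⟨by positivity, ?_⟩
  rw [mul_pow, Real.sq_sqrt hP]
  refine h.trans (mul_le_mul_of_nonneg_right ?_ hP)
  rw [rate, ← Real.exp_nat_mul]
  have := Real.add_one_le_exp (-(1 / √(L i / μ i)))
  have e : ((2 : ℕ) : ℝ) * -(1 / (2 * √(L i / μ i))) = -(1 / √(L i / μ i)) := by
    push_cast; field_simp
  rw [e]
  linarith

end Admissible

end MultiscaleProblem

/-! ### Propagation of errors through the recursion. -/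

namespace MultiscaleProblem

variable {d m : ℕ}

/-- The effect of a procedure at scale `i` with output `z'` on input `z`: it hardly worsens the
larger scales, and it reduces the square roots of the other potentials by the factor `q`, up to
`c` additive errors of size `η`. -/
structure CallBound (Q : MultiscaleProblem d m) (xstar : Vec d) (L μ : Fin m → ℝ) (η : ℝ)
    (i : Fin m) (q c : ℝ) (z z' : Vec d × Vec d) : Prop where
  err_low : ∀ j < i, ∀ A, √(Q.err j z.1) ≤ A → √(Q.err j z.2) ≤ A →
    √(Q.err j z'.1) ≤ A + √(L j / 2) * (c * η) ∧ √(Q.err j z'.2) ≤ A + √(L j / 2) * (c * η)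
  gap_low : ∀ j < i, ∀ A, Q.gap xstar j z.1 ≤ A → Q.gap xstar j z.2 ≤ A →
    Q.gap xstar j z'.1 ≤ A + c * η ∧ Q.gap xstar j z'.2 ≤ A + c * η
  pot_high : ∀ j, i ≤ j →
    √(Q.pot xstar μ j z') ≤ q * √(Q.pot xstar μ j z) + √(L j) * (c * η)

namespace CallBound

variable {Q : MultiscaleProblem d m} {xstar : Vec d} {L μ : Fin m → ℝ} {η : ℝ} {i : Fin m}
  {q q' c c' : ℝ} {z z' z'' : Vec d × Vec d}

lemma refl : CallBound Q xstar L μ η i 1 0 z z := by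
  constructor <;> simp +contextual

/-- Errors of the first call are passed on unchanged or multiplied by `q' ≤ 1`, so their numbers
add. -/
lemma trans (h : CallBound Q xstar L μ η i q c z z') (h' : CallBound Q xstar L μ η i q' c' z' z'')
    (hq0 : 0 ≤ q') (hq : q' ≤ 1) (hc : 0 ≤ c * η) :
    CallBound Q xstar L μ η i (q * q') (c + c') z z'' where
  err_low j hj A h1 h2 := by
    have a := h.err_low j hj A h1 h2
    have b := h'.err_low j hj _ a.1 a.2
    constructor <;> linarith [b.1, b.2]
  gap_low j hj A h1 h2 := by
    have a := h.gap_low j hj A h1 h2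
    have b := h'.gap_low j hj _ a.1 a.2
    constructor <;> linarith [b.1, b.2]
  pot_high j hj := by
    have a := mul_le_mul_of_nonneg_left (h.pot_high j hj) hq0
    have b := h'.pot_high j hj
    have e : 0 ≤ (1 - q') * (√(L j) * (c * η)) :=
      mul_nonneg (by linarith) (mul_nonneg (Real.sqrt_nonneg _) hc)
    linarith

lemma mono (h : CallBound Q xstar L μ η i q c z z') (hη : 0 ≤ η) (hc : c ≤ c') :
    CallBound Q xstar L μ η i q c' z z' where
  err_low j hj A h1 h2 := by
    have a := h.err_low j hj A h1 h2
    exact ⟨a.1.trans (by gcongr), a.2.trans (by gcongr)⟩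
  gap_low j hj A h1 h2 := by
    have a := h.gap_low j hj A h1 h2
    exact ⟨a.1.trans (by gcongr), a.2.trans (by gcongr)⟩
  pot_high j hj := (h.pot_high j hj).trans (by gcongr)

/-- Round `t` may assume the bound for the rounds before it: the error of AGD is controlled only on
a bounded region, and that bound keeps the iterates inside. -/
lemma iterate {F : Vec d × Vec d → Vec d × Vec d} (hη : 0 ≤ η) (hc : 0 ≤ c) (hq0 : 0 ≤ q)
    (hq : q ≤ 1) (T : ℕ)
    (hF : ∀ t < T, CallBound Q xstar L μ η i (q ^ t) (t * c) z (F^[t] z) →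
      CallBound Q xstar L μ η i q c (F^[t] z) (F (F^[t] z))) :
    CallBound Q xstar L μ η i (q ^ T) (T * c) z (F^[T] z) := by
  suffices h : ∀ t ≤ T, CallBound Q xstar L μ η i (q ^ t) (t * c) z (F^[t] z) from h T le_rfl
  intro t
  induction t with
  | zero => intro _; simpa using refl
  | succ t ih =>
    intro ht
    have h := ih (by omega)
    have := h.trans (hF t (by omega) h) hq0 hq (by positivity)
    rw [Function.iterate_succ_apply', pow_succ]
    convert this using 1
    push_cast; ring

variable {lo hi : ℝ} (hA : Q.Admissible L μ lo hi) (hmin : IsMinOn Q.obj Set.univ xstar)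
include hA hmin

/-- On blocks before `i` distances grow only by the errors. On the others one passes to the
potential and back, at the cost `√(2 Lⱼ/μⱼ) ≤ 2 √(hi/lo)`. -/
lemma gap_le (h : CallBound Q xstar L μ η i q c z z') (hq : q ≤ 1) (hc : 0 ≤ c * η) {σ : ℝ}
    (h1 : ∀ j, Q.gap xstar j z.1 ≤ σ) (h2 : ∀ j, Q.gap xstar j z.2 ≤ σ) (j : Fin m) :
    Q.gap xstar j z'.1 ≤ 2 * √(hi / lo) * (σ + c * η) ∧
      Q.gap xstar j z'.2 ≤ 2 * √(hi / lo) * (σ + c * η) := by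
  have hσ : 0 ≤ σ := (Q.gap_nonneg j _).trans (h1 j)
  have hk : 1 ≤ √(hi / lo) := Real.one_le_sqrt.2 (hA.one_le_cond j)
  rcases lt_or_ge j i with hj | hj
  · have a := h.gap_low j hj σ (h1 j) (h2 j)
    have : σ + c * η ≤ 2 * √(hi / lo) * (σ + c * η) :=
      le_mul_of_one_le_left (by positivity) (by linarith)
    exact ⟨a.1.trans this, a.2.trans this⟩
  · have a : √(Q.pot xstar μ j z') ≤ √(L j) * (σ + c * η) := by
      refine (h.pot_high j hj).trans ?_
      have b := hA.sqrt_pot_le_of_gap_le hmin (h1 j) (h2 j)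
      have : q * √(Q.pot xstar μ j z) ≤ √(Q.pot xstar μ j z) :=
        mul_le_of_le_one_left (Real.sqrt_nonneg _) hq
      linarith
    have b := hA.gap_le_of_sqrt_pot_le hmin a
    have e : √(2 / μ j) * (√(L j) * (σ + c * η)) ≤ 2 * √(hi / lo) * (σ + c * η) := by
      rw [← mul_assoc]
      refine mul_le_mul_of_nonneg_right ?_ (by positivity)
      have hμ := hA.μ_pos j
      rw [← Real.sqrt_mul (by positivity)]
      apply Real.sqrt_le_iff.2 ⟨by positivity, ?_⟩
      have h0 : 0 ≤ hi / lo := zero_le_one.trans (hA.one_le_cond j)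
      rw [mul_pow, Real.sq_sqrt h0, div_mul_eq_mul_div, div_le_iff₀ hμ]
      have := hA.L_le_mul j j
      nlinarith [hA.L_pos j]
    exact ⟨b.1.trans e, b.2.trans e⟩

/-- One round at the last scale. -/
lemma last_round {u w : Vec d × Vec d} (hi' : ∀ j, j ≤ i)
    (hw1 : ‖w.1 - (exactAGD Q.obj u.1 u.2 (L i) (μ i)).1‖ ≤ η)
    (hw2 : ‖w.2 - (exactAGD Q.obj u.1 u.2 (L i) (μ i)).2‖ ≤ η) :
    CallBound Q xstar L μ η i (rate L μ i) 1 u w where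
  err_low j hj A h1 h2 := by
    rw [one_mul]
    exact hA.step_err hmin hw1 hw2 hj h1 h2
  gap_low j hj A h1 h2 := by
    rw [one_mul]
    exact hA.step_gap_low hmin hw1 hw2 hj h1 h2
  pot_high j hj := by
    rw [one_mul, le_antisymm (hi' j) hj]
    exact hA.step_pot hmin hw1 hw2

/-- One round at a scale before the last one, with inner calls that reduce potentials by `q`. -/
lemma inner_round {u w r s : Vec d × Vec d} {i' : Fin m} (hi' : ∀ j, j < i' ↔ j ≤ i)
    (hw1 : ‖w.1 - (exactAGD Q.obj u.1 u.2 (L i) (μ i)).1‖ ≤ η)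
    (hw2 : ‖w.2 - (exactAGD Q.obj u.1 u.2 (L i) (μ i)).2‖ ≤ η)
    (hr : CallBound Q xstar L μ η i' q c (w.1, w.1) r)
    (hs : CallBound Q xstar L μ η i' q c (w.2, w.2) s)
    (hq0 : 0 ≤ q) (hq : 2 * (hi / lo) ^ 2 * q ≤ Real.exp (-(1 / 2))) (hc : 0 ≤ c) :
    CallBound Q xstar L μ η i (rate L μ i) (2 * (1 + c)) u (r.1, s.2) := by
  have hη : 0 ≤ η := (norm_nonneg _).trans hw1
  refine ⟨fun j hj A h1 h2 => ?_, fun j hj A h1 h2 => ?_, fun j hj => ?_⟩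
  · have a := hA.step_err hmin hw1 hw2 hj h1 h2
    have b := (hr.err_low j ((hi' j).2 hj.le) _ a.1 a.1).1
    have b' := (hs.err_low j ((hi' j).2 hj.le) _ a.2 a.2).2
    have : 0 ≤ √(L j / 2) * ((1 + c) * η) := by positivity
    constructor <;> simp only <;> linarith
  · have a := hA.step_gap_low hmin hw1 hw2 hj h1 h2
    have b := (hr.gap_low j ((hi' j).2 hj.le) _ a.1 a.1).1
    have b' := (hs.gap_low j ((hi' j).2 hj.le) _ a.2 a.2).2
    have : 0 ≤ (1 + c) * η := by positivity
    constructor <;> simp only <;> linarith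
  · rcases hj.eq_or_lt with rfl | hj
    · have a := hA.step_pot hmin hw1 hw2
      -- Each inner call starts from a pair of equal points, so it preserves the value or distance
      -- of its own component; a joint call on `w` would only control the maximum over both
      -- components.
      have b := (hr.err_low i ((hi' i).2 le_rfl) _ le_rfl le_rfl).1
      have b' := (hs.gap_low i ((hi' i).2 le_rfl) _ le_rfl le_rfl).2
      have e := hA.sqrt_pot_le_add hmin (z := w) (z' := (r.1, s.2)) (by positivity) b b'
      have : 0 ≤ √(L i) * ((1 + c) * η) := by positivity
      linarith
    · have hij : i' ≤ j := not_lt.1 fun h => absurd ((hi' j).1 h) (not_le.2 hj)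
      have hμ := hA.μ_pos j
      have hL := hA.L_pos j
      have hκ1 := hA.one_le_cond j
      have hLκ := hA.L_le_mul j j
      set κ := hi / lo
      set P := √(Q.pot xstar μ j u) with hP
      have hP0 : 0 ≤ P := Real.sqrt_nonneg _
      have a := hA.gap_le_of_sqrt_pot_le hmin (z := u) hP.ge
      have a' := hA.step_gap_any hmin hw1 hw2 a.1 a.2
      set σ := κ * (√(2 / μ j) * P) + η
      have b := (hr.pot_high j hij).trans (add_le_add_left (mul_le_mul_of_nonneg_left
        (hA.sqrt_pot_le_of_gap_le hmin (z := (w.1, w.1)) a'.1 a'.1) hq0) _)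
      have b' := (hs.pot_high j hij).trans (add_le_add_left (mul_le_mul_of_nonneg_left
        (hA.sqrt_pot_le_of_gap_le hmin (z := (w.2, w.2)) a'.2 a'.2) hq0) _)
      set B := q * (√(L j) * σ) + √(L j) * (c * η) with hB
      have hB0 : 0 ≤ B := (Real.sqrt_nonneg _).trans b
      have b1 := (Real.sqrt_le_left hB0).1 b
      have b2 := (Real.sqrt_le_left hB0).1 b'
      have h3 := Q.err_nonneg hmin j s.1
      have h4 : 0 ≤ μ j / 2 * Q.gap xstar j r.2 ^ 2 := by positivity
      have h5 : √(Q.pot xstar μ j (r.1, s.2)) ≤ √2 * B := by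
        apply Real.sqrt_le_iff.2 ⟨by positivity, ?_⟩
        rw [mul_pow, Real.sq_sqrt (by norm_num)]
        simp only [pot] at b1 b2 ⊢
        linarith
      have h6 : √2 * √(L j) * √(2 / μ j) ≤ 2 * κ := by
        rw [← Real.sqrt_mul (by norm_num), ← Real.sqrt_mul (by positivity)]
        apply Real.sqrt_le_iff.2 ⟨by positivity, ?_⟩
        have : L j / μ j ≤ κ := (div_le_iff₀ hμ).2 hLκ
        have e : 2 * L j * (2 / μ j) = 4 * (L j / μ j) := by ring
        rw [e]
        nlinarith
      have h7 : q ≤ 1 := by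
        have e1 : Real.exp (-(1 / 2)) ≤ 1 := Real.exp_le_one_iff.2 (by norm_num)
        nlinarith [mul_le_mul_of_nonneg_right (one_le_pow₀ (n := 2) hκ1) hq0]
      have h8 : √2 ≤ 2 := Real.sqrt_le_iff.2 ⟨by norm_num, by norm_num⟩
      have h9 : √2 * B = q * κ * (√2 * √(L j) * √(2 / μ j)) * P +
          √2 * (√(L j) * ((q + c) * η)) := by
        rw [hB]; ring
      have h10 : q * κ * (√2 * √(L j) * √(2 / μ j)) * P ≤ q * κ * (2 * κ) * P := by gcongr
      -- This uses the factor `2κ²` in `hq`: `κ` for the AGD step, `2κ` for passing from potential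
      -- to distance and back and for joining two calls.
      have h11 : q * κ * (2 * κ) * P ≤ rate L μ i * P := by
        gcongr
        linarith [hA.exp_neg_half_le_rate i]
      have h12 : √2 * (√(L j) * ((q + c) * η)) ≤ 2 * (√(L j) * ((1 + c) * η)) := by gcongr
      linarith

end CallBound

/-- Induction on the number `k` of scales after `i`. A round makes `2 (1 + c) ≤ 4 c` errors, where
`c ≥ 1` bounds those of an inner call; this gives `4 ^ k ∏ T`. The condition on `R` keeps all
iterates where `agd` is accurate: descending one level enlarges the radius by at most `2κ²`, and
iterating within a level by at most `2√κ`. -/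
lemma acbsls_bound {Q : MultiscaleProblem d m} {xstar : Vec d} {L μ : Fin m → ℝ} {lo hi : ℝ}
    (hA : Q.Admissible L μ lo hi) (hmin : IsMinOn Q.obj Set.univ xstar) {agd : AGDRoutine d}
    {η R : ℝ} (hη : 0 ≤ η)
    (hagd : ∀ i x v, (∀ j, Q.gap xstar j x ≤ R) → (∀ j, Q.gap xstar j v ≤ R) →
      ‖(agd x v (L i) (μ i)).1 - (exactAGD Q.obj x v (L i) (μ i)).1‖ ≤ η ∧
      ‖(agd x v (L i) (μ i)).2 - (exactAGD Q.obj x v (L i) (μ i)).2‖ ≤ η)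
    {T : Fin m → ℕ} (hT1 : ∀ i : Fin m, 0 < i.val → 1 ≤ T i)
    (hT : ∀ i : Fin m, 0 < i.val →
      2 * (hi / lo) ^ 2 * rate L μ i ^ T i ≤ Real.exp (-(1 / 2)))
    (k : ℕ) : ∀ (i : Fin m), i.val + k + 1 = m → ∀ (z : Vec d × Vec d) (σ : ℝ),
      (∀ j, Q.gap xstar j z.1 ≤ σ) → (∀ j, Q.gap xstar j z.2 ≤ σ) →
      2 * √(hi / lo) * (2 * (hi / lo) ^ 2) ^ k *
        (σ + 4 ^ k * (∏ j ∈ Finset.Ici i, (T j : ℝ)) * η) ≤ R →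
      CallBound Q xstar L μ η i (rate L μ i ^ T i) (4 ^ k * ∏ j ∈ Finset.Ici i, (T j : ℝ)) z
        (acbsls agd L μ T i z) := by
  induction k with
  | zero =>
    intro i hi' z σ hz1 hz2 hR
    have hlast : ∀ j : Fin m, j ≤ i := fun j => Fin.le_def.2 (by omega)
    have hIci : Finset.Ici i = {i} := by
      ext j; simp only [Finset.mem_Ici, Finset.mem_singleton]
      exact ⟨fun h => le_antisymm (hlast j) h, fun h => h.ge⟩
    rw [acbsls]
    rw [hIci] at hR ⊢
    simp only [Finset.prod_singleton, pow_zero, one_mul, mul_one] at hR ⊢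
    rw [← mul_one (T i : ℝ)]
    apply CallBound.iterate hη zero_le_one (rate_pos L μ i).le (rate_le_one L μ i)
    intro t ht hu
    have hg := hu.gap_le hA hmin (pow_le_one₀ (rate_pos L μ i).le (rate_le_one L μ i))
      (by positivity) hz1 hz2
    have hle : 2 * √(hi / lo) * (σ + t * 1 * η) ≤ R := by
      refine le_trans ?_ hR
      rw [mul_one]
      gcongr
    rw [dif_neg (by omega)]
    have ha := hagd i _ _ (fun j => (hg j).1.trans hle) (fun j => (hg j).2.trans hle)
    exact CallBound.last_round hA hmin hlast ha.1 ha.2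
  | succ k ih =>
    intro i hi' z σ hz1 hz2 hR
    have hlt : i.val + 1 < m := by omega
    set i' : Fin m := ⟨i.val + 1, hlt⟩ with hi'def
    have hσ : 0 ≤ σ := (Q.gap_nonneg i _).trans (hz1 i)
    have hIci : Finset.Ici i = insert i (Finset.Ici i') := by
      ext j
      simp only [Finset.mem_Ici, Finset.mem_insert, Fin.le_def, Fin.ext_iff, hi'def]
      omega
    have hni : i ∉ Finset.Ici i' := by simp [Fin.le_def, hi'def]
    have hκ1 := hA.one_le_cond i
    set κ := hi / lo
    set c := 4 ^ k * ∏ j ∈ Finset.Ici i', (T j : ℝ) with hc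
    have hc1 : 1 ≤ c := by
      apply one_le_mul_of_one_le_of_one_le (one_le_pow₀ (by norm_num))
      have : 0 < ∏ j ∈ Finset.Ici i', T j := by
        apply Finset.prod_pos
        intro j hj
        refine hT1 j ?_
        simp only [Finset.mem_Ici, Fin.le_def, hi'def] at hj
        omega
      exact_mod_cast this
    have hcT : (T i : ℝ) * (2 * (1 + c)) ≤ 4 ^ (k + 1) * ∏ j ∈ Finset.Ici i, (T j : ℝ) := by
      rw [hIci, Finset.prod_insert hni]
      calc (T i : ℝ) * (2 * (1 + c)) ≤ T i * (4 * c) :=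
            mul_le_mul_of_nonneg_left (by linarith) (Nat.cast_nonneg _)
        _ = _ := by rw [hc]; ring
    have hR' : 2 * √κ * (2 * κ ^ 2) ^ (k + 1) * (σ + T i * (2 * (1 + c)) * η) ≤ R :=
      le_trans (by gcongr) hR
    refine CallBound.mono ?_ hη hcT
    rw [acbsls]
    apply CallBound.iterate hη (by positivity) (rate_pos L μ i).le (rate_le_one L μ i)
    intro t ht hu
    have hg := hu.gap_le hA hmin (pow_le_one₀ (rate_pos L μ i).le (rate_le_one L μ i))
      (by positivity) hz1 hz2
    have hpow : 1 ≤ (2 * κ ^ 2) ^ (k + 1) := one_le_pow₀ (by nlinarith)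
    have hs1 : 1 ≤ √κ := Real.one_le_sqrt.2 hκ1
    have ht' : (t : ℝ) + 1 ≤ T i := by exact_mod_cast ht
    have hle : 2 * √κ * (σ + t * (2 * (1 + c)) * η) ≤ R := by
      refine le_trans ?_ hR'
      calc 2 * √κ * (σ + t * (2 * (1 + c)) * η)
          ≤ 2 * √κ * (σ + T i * (2 * (1 + c)) * η) := by gcongr
        _ = 2 * √κ * 1 * (σ + T i * (2 * (1 + c)) * η) := by ring
        _ ≤ _ := by gcongr
    set u := _^[t] z
    have ha := hagd i _ _ (fun j => (hg j).1.trans hle) (fun j => (hg j).2.trans hle)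
    have hw := fun j => hA.step_gap_any hmin ha.1 ha.2 (hg j).1 (hg j).2
    have hsq : √κ ^ 2 = κ := Real.sq_sqrt (by linarith)
    have hin : 2 * √κ * (2 * κ ^ 2) ^ k *
        (κ * (2 * √κ * (σ + t * (2 * (1 + c)) * η)) + η + c * η) ≤ R := by
      refine le_trans ?_ hR'
      have e : 2 * √κ * (2 * κ ^ 2) ^ (k + 1) * (σ + T i * (2 * (1 + c)) * η) =
          2 * √κ * (2 * κ ^ 2) ^ k * (2 * κ ^ 2 * (σ + T i * (2 * (1 + c)) * η)) := by ring
      rw [e]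
      refine mul_le_mul_of_nonneg_left ?_ (by positivity)
      have h1 : κ * (2 * √κ * (σ + t * (2 * (1 + c)) * η)) ≤
          2 * κ ^ 2 * (σ + t * (2 * (1 + c)) * η) := by
        have : √κ ≤ κ := by nlinarith
        calc κ * (2 * √κ * (σ + t * (2 * (1 + c)) * η))
            ≤ κ * (2 * κ * (σ + t * (2 * (1 + c)) * η)) := by gcongr
          _ = _ := by ring
      have h2 : (1 + c) * η ≤ 2 * κ ^ 2 * (2 * (1 + c) * η) := by
        have : 0 ≤ (1 + c) * η := by positivity
        nlinarith [one_le_pow₀ (n := 2) hκ1]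
      have h3 : 2 * κ ^ 2 * (σ + (t + 1) * (2 * (1 + c)) * η) ≤
          2 * κ ^ 2 * (σ + T i * (2 * (1 + c)) * η) := by gcongr
      linarith
    rw [dif_pos hlt]
    refine CallBound.inner_round hA hmin (i' := i')
      (fun j => by simp only [Fin.lt_def, Fin.le_def, hi'def]; omega) ha.1 ha.2
      (ih i' (by simp only [hi'def]; omega) _ _ (fun j => (hw j).1) (fun j => (hw j).1) hin)
      (ih i' (by simp only [hi'def]; omega) _ _ (fun j => (hw j).2) (fun j => (hw j).2) hin)
      (pow_nonneg (rate_pos L μ i').le _) (hT i' (by simp [hi'def])) (by positivity)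

end MultiscaleProblem

lemma MulApprox.norm_sub_le {d : ℕ} {δ : ℝ} (hδ : 0 ≤ δ) {xh x : Vec d} (h : MulApprox δ xh x) :
    ‖xh - x‖ ≤ δ * ‖x‖ := by
  apply abs_le_of_sq_le_sq' _ (by positivity) |>.2
  rw [mul_pow, EuclideanSpace.real_norm_sq_eq, EuclideanSpace.real_norm_sq_eq, Finset.mul_sum]
  apply Finset.sum_le_sum
  intro k _
  have := pow_le_pow_left₀ (abs_nonneg _) (h k) 2
  rwa [mul_pow, sq_abs, sq_abs] at this

/-! ### Numerical consequences of the precision bounds, with `a = δ ∏ T` and `m = k + 1`. -/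

section Arithmetic

variable {a κ ε ψ hi lo X : ℝ} {k : ℕ}

lemma natCast_add_one_le_two_pow (k : ℕ) : ((k + 1 : ℕ) : ℝ) ≤ 2 ^ k := by
  exact_mod_cast Nat.lt_two_pow_self (n := k)

lemma two_mul_precision_eq (κ : ℝ) (k : ℕ) :
    2 * (10 * κ ^ 2) ^ (2 * (k + 1) - 1) = 20 * κ ^ 2 * (100 * κ ^ 4) ^ k := by
  have e : 2 * (k + 1) - 1 = 2 * k + 1 := by omega
  rw [e, pow_succ, pow_mul]
  ring

/-- Errors enlarge the iterates and thereby the later relative errors; this amplification is at most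
one half. -/
lemma feedback_le (ha : 0 ≤ a) (hκ : 1 ≤ κ) (h1 : a * (20 * κ ^ 2 * (100 * κ ^ 4) ^ k) ≤ 1) :
    a * (√((k + 1 : ℕ) : ℝ) * κ * (2 * √κ * (2 * κ ^ 2) ^ k) * 4 ^ k) ≤ 1 / 2 := by
  have hN := natCast_add_one_le_two_pow k
  have hN1 : (1 : ℝ) ≤ ((k + 1 : ℕ) : ℝ) := by simp
  have hsN : √((k + 1 : ℕ) : ℝ) ≤ 2 ^ k :=
    (Real.sqrt_le_iff.2 ⟨by positivity, by nlinarith⟩).trans hN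
  have hsκ : √κ ≤ κ := Real.sqrt_le_iff.2 ⟨by positivity, by nlinarith⟩
  have h2 : κ ^ 2 ≤ κ ^ 4 := pow_le_pow_right₀ hκ (by norm_num)
  calc a * (√((k + 1 : ℕ) : ℝ) * κ * (2 * √κ * (2 * κ ^ 2) ^ k) * 4 ^ k)
      ≤ a * (2 ^ k * κ * (2 * κ * (2 * κ ^ 2) ^ k) * 4 ^ k) := by gcongr
    _ = a * (2 * κ ^ 2 * (16 * κ ^ 2) ^ k) := by
        have : (16 * κ ^ 2) ^ k = 2 ^ k * (2 * κ ^ 2) ^ k * 4 ^ k := by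
          rw [← mul_pow, ← mul_pow]; ring
        rw [this]; ring
    _ ≤ a * (10 * κ ^ 2 * (100 * κ ^ 4) ^ k) := by gcongr <;> norm_num
    _ ≤ 1 / 2 := by linarith

/-- The square of the left side is quadratic in `a`: one factor `a` is spent on `h1`, the other on
`h2`. -/
lemma accumulated_error_le (ha : 0 ≤ a) (hκ : 1 ≤ κ) (hlo : 0 < lo) (hhi : hi = κ * lo)
    (hψ : 0 ≤ ψ) (hε : 0 < ε) (h1 : a * (20 * κ ^ 2 * (100 * κ ^ 4) ^ k) ≤ 1)
    (h2 : a * (20 * κ ^ 2 * (100 * κ ^ 4) ^ k * ((k + 1 : ℕ) : ℝ) * ψ) ≤ ε) :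
    √(((k + 1 : ℕ) : ℝ) * hi) * (4 ^ k * (a * (2 * (√((k + 1 : ℕ) : ℝ) * κ *
      (2 * √κ * (2 * κ ^ 2) ^ k) * √(2 * ψ / lo))))) ≤ 3 / 10 * √ε := by
  have hN := natCast_add_one_le_two_pow k
  set N : ℝ := ((k + 1 : ℕ) : ℝ)
  have hN0 : 0 ≤ N := Nat.cast_nonneg _
  have hhi0 : 0 ≤ hi := by rw [hhi]; positivity
  apply abs_le_of_sq_le_sq' _ (by positivity) |>.2
  simp only [mul_pow]
  rw [Real.sq_sqrt (by positivity), Real.sq_sqrt hN0, Real.sq_sqrt (by positivity : (0:ℝ) ≤ κ),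
    Real.sq_sqrt (by positivity), Real.sq_sqrt hε.le]
  have h3 := mul_le_mul h1 h2 (by positivity) zero_le_one
  have h4 : (N * (64 * κ ^ 4) ^ k) ≤ (10000 * κ ^ 8) ^ k := by
    calc N * (64 * κ ^ 4) ^ k ≤ 2 ^ k * (64 * κ ^ 4) ^ k := by gcongr
      _ = (128 * κ ^ 4) ^ k := by rw [← mul_pow]; ring
      _ ≤ (10000 * κ ^ 8) ^ k := by
        have : κ ^ 4 ≤ κ ^ 8 := pow_le_pow_right₀ hκ (by norm_num)
        gcongr; norm_num
  calc _ = 32 * (a ^ 2 * κ ^ 4 * (N * ψ)) * (N * (64 * κ ^ 4) ^ k) := by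
        have : (64 * κ ^ 4) ^ k = (4 ^ k) ^ 2 * ((2 ^ k) ^ 2 * ((κ ^ 2) ^ k) ^ 2) := by
          rw [pow_right_comm 4, pow_right_comm 2, pow_right_comm (κ ^ 2), ← mul_pow, ← mul_pow]
          congr 1; ring
        rw [this, hhi]
        field_simp
        ring
    _ ≤ 32 * (a ^ 2 * κ ^ 4 * (N * ψ)) * (10000 * κ ^ 8) ^ k := by gcongr
    _ = 32 / 400 * (a * (20 * κ ^ 2 * (100 * κ ^ 4) ^ k) *
          (a * (20 * κ ^ 2 * (100 * κ ^ 4) ^ k * N * ψ))) := by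
        have : (10000 * κ ^ 8) ^ k = (100 * κ ^ 4) ^ k * (100 * κ ^ 4) ^ k := by
          rw [← mul_pow]; ring
        rw [this]; ring
    _ ≤ 32 / 400 * (1 * ε) := by gcongr
    _ ≤ _ := by linarith

/-- Again one factor `a` goes to `h1` and one to `h3`, with growth rates `300 = 100 · 3`. -/
lemma accumulated_offset_error_le (ha : 0 ≤ a) (hκ : 1 ≤ κ) (hhi : 0 ≤ hi)
    (hε : 0 < ε) (h1 : a * (20 * κ ^ 2 * (100 * κ ^ 4) ^ k) ≤ 1)
    (h3 : a * (4 * 3 ^ (k + 1 + 1) * (((k + 1 : ℕ) : ℝ) * hi * κ) * X ^ 2) ≤ ε) :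
    √(((k + 1 : ℕ) : ℝ) * hi) * (4 ^ k * (a * (2 * X))) ≤ 1 / 10 * √ε := by
  set N : ℝ := ((k + 1 : ℕ) : ℝ)
  have hN0 : 0 ≤ N := Nat.cast_nonneg _
  apply abs_le_of_sq_le_sq' _ (by positivity) |>.2
  simp only [mul_pow]
  rw [Real.sq_sqrt (by positivity), Real.sq_sqrt hε.le]
  have h4 : a * (20 * 100 ^ k) ≤ 1 := by
    refine le_trans ?_ h1
    have e1 : 1 ≤ κ ^ 2 := one_le_pow₀ hκ
    have e2 : 1 ≤ κ ^ 4 := one_le_pow₀ hκ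
    gcongr <;> linarith
  have h5 : a * (36 * 3 ^ k * (N * hi) * X ^ 2) ≤ ε := by
    refine le_trans ?_ h3
    have e1 : N * hi ≤ N * hi * κ := le_mul_of_one_le_right (by positivity) hκ
    have e2 : (4 : ℝ) * 3 ^ (k + 1 + 1) = 36 * 3 ^ k := by ring
    rw [e2]
    gcongr
  have h6 := mul_le_mul h4 h5 (by positivity) zero_le_one
  calc N * hi * ((4 ^ k) ^ 2 * (a ^ 2 * (2 ^ 2 * X ^ 2))) = 4 * (N * hi * a ^ 2 * X ^ 2) * 16 ^ k := by
        rw [← pow_mul, mul_comm k 2, pow_mul]; norm_num; ring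
    _ ≤ 4 * (N * hi * a ^ 2 * X ^ 2) * 300 ^ k := by gcongr; norm_num
    _ = 4 / 720 * (a * (20 * 100 ^ k) * (a * (36 * 3 ^ k * (N * hi) * X ^ 2))) := by
        have : (300 : ℝ) ^ k = 100 ^ k * 3 ^ k := by rw [← mul_pow]; norm_num
        rw [this]; ring
    _ ≤ 4 / 720 * (1 * ε) := by gcongr
    _ ≤ _ := by linarith

end Arithmetic

/-! ### The final potential for arbitrary admissible parameters. -/

namespace MultiscaleProblem

variable {d m : ℕ}

lemma rate_pow_mul_sqrt_le {L μ : Fin m → ℝ} {i : Fin m} {T : ℕ} {ψ ε : ℝ} (hψ : 0 ≤ ψ)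
    (hε : 0 < ε) (hk : 0 < L i / μ i) (hT : √(L i / μ i) * Real.log (ψ / ε) ≤ T) :
    rate L μ i ^ T * √ψ ≤ √ε := by
  have hr := rate_pos L μ i
  apply Real.le_sqrt_of_sq_le
  rw [mul_pow, Real.sq_sqrt hψ, ← pow_mul, rate, ← Real.exp_nat_mul]
  rcases hψ.eq_or_lt with rfl | hψ
  · simpa using hε.le
  have hs := Real.sqrt_pos.2 hk
  have e : ((T * 2 : ℕ) : ℝ) * -(1 / (2 * √(L i / μ i))) = -(T / √(L i / μ i)) := by
    push_cast; field_simp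
  have h1 : Real.log (ψ / ε) ≤ T / √(L i / μ i) := by
    rw [le_div_iff₀ hs]; linarith
  rw [e, Real.exp_neg, inv_mul_le_iff₀ (Real.exp_pos _), ← div_le_iff₀ hε]
  exact (Real.log_le_iff_le_exp (by positivity)).1 h1

/-- As `log (4κ⁴) + 1 = 2 (log (2κ²) + 1/2)` and `rate` has a halved exponent, the power cancels
`2κ²` and leaves `exp (-1/2)`. -/
lemma two_mul_sq_mul_rate_pow_le {L μ : Fin m → ℝ} {i : Fin m} {T : ℕ} {κ : ℝ} (hκ : 0 < κ)
    (hk : 0 < L i / μ i) (hT : √(L i / μ i) * (Real.log (4 * κ ^ 4) + 1) ≤ T) :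
    2 * κ ^ 2 * rate L μ i ^ T ≤ Real.exp (-(1 / 2)) := by
  have hs := Real.sqrt_pos.2 hk
  have h1 : Real.log (4 * κ ^ 4) + 1 ≤ T / √(L i / μ i) := by
    rw [le_div_iff₀ hs]; linarith
  have h2 : Real.log (4 * κ ^ 4) = 2 * Real.log (2 * κ ^ 2) := by
    rw [show 4 * κ ^ 4 = (2 * κ ^ 2) ^ 2 by ring, Real.log_pow]; norm_num
  rw [rate, ← Real.exp_nat_mul]
  have e : (T : ℝ) * -(1 / (2 * √(L i / μ i))) = -(T / √(L i / μ i) / 2) := by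
    field_simp
  rw [e]
  calc 2 * κ ^ 2 * Real.exp (-(T / √(L i / μ i) / 2))
      = Real.exp (Real.log (2 * κ ^ 2) + -(T / √(L i / μ i) / 2)) := by
        rw [Real.exp_add, Real.exp_log (by positivity)]
    _ ≤ _ := Real.exp_le_exp.2 (by linarith)

/-- Formulated for admissible parameters so that it serves the true and the guessed ones alike. -/
theorem sum_pot_acbsls_le [NeZero m] {Q : MultiscaleProblem d m} {xstar : Vec d}
    {L μ : Fin m → ℝ} {lo hi : ℝ} (hA : Q.Admissible L μ lo hi)
    (hmin : IsMinOn Q.obj Set.univ xstar) {agd : AGDRoutine d} {δ : ℝ} (hδ : 0 < δ)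
    (hagd : ∀ i, AccurateAt Q.obj δ agd (L i) (μ i)) {T : Fin m → ℕ} {z : Vec d × Vec d}
    {ψ ε : ℝ} (hε : 0 < ε) (hψ : ∑ i, Q.pot xstar μ i z ≤ ψ)
    (hT0 : √(L 0 / μ 0) * Real.log (ψ / ε) ≤ T 0)
    (hT : ∀ i, i ≠ 0 → √(L i / μ i) * (Real.log (4 * (hi / lo) ^ 4) + 1) ≤ T i)
    (h1 : δ * (∏ i, (T i : ℝ)) * (2 * (10 * (hi / lo) ^ 2) ^ (2 * m - 1)) ≤ 1)
    (h2 : δ * (∏ i, (T i : ℝ)) * (2 * (10 * (hi / lo) ^ 2) ^ (2 * m - 1) * m * ψ) ≤ ε)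
    (h3 : δ * (∏ i, (T i : ℝ)) * (4 * 3 ^ (m + 1) * (m * hi * (hi / lo)) * ‖xstar‖ ^ 2) ≤ ε) :
    ∑ i, Q.pot xstar μ i (acbsls agd L μ T 0 z) ≤ 3 * ε := by
  have hκ := hA.one_le_cond 0
  have hlo := hA.lo_pos
  have hhi : hi = hi / lo * lo := by rw [div_mul_cancel₀ _ hlo.ne']
  have hhi0 : 0 ≤ hi := (hA.L_pos 0).le.trans (hA.le_hi 0)
  have hk : ∀ i, 0 < L i / μ i := fun i => div_pos (hA.L_pos i) (hA.μ_pos i)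
  have hpot := hA.pot_nonneg hmin
  have hψ0 : 0 ≤ ψ := (Finset.sum_nonneg fun i _ => hpot i z).trans hψ
  have hT' : ∀ i : Fin m, 0 < i.val →
      2 * (hi / lo) ^ 2 * rate L μ i ^ T i ≤ Real.exp (-(1 / 2)) := fun i hi' =>
    two_mul_sq_mul_rate_pow_le (by linarith) (hk i)
      (hT i (by rintro rfl; simp at hi'))
  -- `T i = 0` would turn `hT'` into `2κ² ≤ exp (-1/2)`, which fails for `κ ≥ 1`.
  have hT1 : ∀ i : Fin m, 0 < i.val → 1 ≤ T i := by
    intro i hi'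
    by_contra h0
    have h := hT' i hi'
    rw [show T i = 0 by omega, pow_zero, mul_one] at h
    have : Real.exp (-(1 / 2)) ≤ 1 := Real.exp_le_one_iff.2 (by norm_num)
    nlinarith
  obtain ⟨k, rfl⟩ : ∃ k, m = k + 1 := ⟨m - 1, by have := NeZero.pos m; omega⟩
  rw [two_mul_precision_eq] at h1 h2
  set κ := hi / lo
  set N : ℝ := ((k + 1 : ℕ) : ℝ) with hN
  have hN0 : 0 ≤ N := Nat.cast_nonneg _
  set P : ℝ := ∏ i, (T i : ℝ) with hP
  have hP0 : 0 ≤ P := by positivity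
  set g := 2 * √κ * (2 * κ ^ 2) ^ k with hg
  have hg0 : 0 ≤ g := by positivity
  set σ := √(2 * ψ / lo) with hσ
  set c := 4 ^ k * P with hc
  -- `η` has to bound `δ (√N κ R + ‖xstar‖)`, where `R` itself contains `c η`. The factor 2 sums the
  -- geometric series of ratio at most 1/2 given by `hfb`.
  set η := δ * (2 * (√N * κ * g * σ + ‖xstar‖)) with hη
  have hη0 : 0 ≤ η := by positivity
  have hfb := feedback_le (mul_nonneg hδ.le hP0) hκ h1
  have hacc := accumulated_error_le (mul_nonneg hδ.le hP0) hκ hlo hhi hψ0 hε h1 h2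
  have hoff := accumulated_offset_error_le (mul_nonneg hδ.le hP0) hκ hhi0 hε
    h1 h3
  set R := g * (σ + c * η) with hR
  have hηR : δ * (√N * (κ * R) + ‖xstar‖) ≤ η := by
    have e : δ * (√N * (κ * R) + ‖xstar‖) =
        η / 2 + δ * P * (√N * κ * g * 4 ^ k) * η := by
      rw [hR, hc, hη]; ring
    rw [e]
    have := mul_le_mul_of_nonneg_right hfb hη0
    linarith
  have hacc' : ∀ i x v, (∀ j, Q.gap xstar j x ≤ R) → (∀ j, Q.gap xstar j v ≤ R) →
      ‖(agd x v (L i) (μ i)).1 - (exactAGD Q.obj x v (L i) (μ i)).1‖ ≤ η ∧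
      ‖(agd x v (L i) (μ i)).2 - (exactAGD Q.obj x v (L i) (μ i)).2‖ ≤ η := by
    intro i x v hx hv
    have hgap := fun j => hA.step_gap_any hmin (i := i) (x := x) (v := v)
      (w := exactAGD Q.obj x v (L i) (μ i)) (η := 0) (by simp) (by simp) (hx j) (hv j)
    simp only [add_zero] at hgap
    have hκR : 0 ≤ κ * R := (Q.gap_nonneg 0 _).trans (hgap 0).1
    have hnorm : ∀ w : Vec d, (∀ j, Q.gap xstar j w ≤ κ * R) → δ * ‖w‖ ≤ η := by
      intro w hw
      refine le_trans ?_ hηR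
      gcongr
      have := Q.norm_le_of_block_le hw hκR
      have h' := norm_add_le (w - xstar) xstar
      rw [sub_add_cancel] at h'
      linarith
    exact ⟨((hagd i x v).1.norm_sub_le hδ.le).trans (hnorm _ fun j => (hgap j).1),
      ((hagd i x v).2.norm_sub_le hδ.le).trans (hnorm _ fun j => (hgap j).2)⟩
  have hpotψ : ∀ j, Q.pot xstar μ j z ≤ ψ := fun j =>
    (Finset.single_le_sum (f := fun j => Q.pot xstar μ j z) (fun i _ => hpot i z)
      (Finset.mem_univ j)).trans hψ
  have hz : ∀ j, Q.gap xstar j z.1 ≤ σ ∧ Q.gap xstar j z.2 ≤ σ := by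
    intro j
    have h := hA.gap_le_of_sqrt_pot_le hmin (Real.sqrt_le_sqrt (hpotψ j))
    have e : √(2 / μ j) * √ψ ≤ σ := by
      rw [← Real.sqrt_mul (div_nonneg zero_le_two (hA.μ_pos j).le), hσ]
      apply Real.sqrt_le_sqrt
      rw [div_mul_eq_mul_div]
      gcongr
      exact hA.lo_le j
    exact ⟨h.1.trans e, h.2.trans e⟩
  have hIci : Finset.Ici (0 : Fin (k + 1)) = Finset.univ := by ext j; simp
  have hb := acbsls_bound hA hmin hη0 hacc' hT1 hT' k 0 (by simp) z σ (fun j => (hz j).1)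
    (fun j => (hz j).2) (by rw [hIci])
  rw [hIci] at hb
  have hq0 : 0 ≤ rate L μ 0 ^ T 0 := pow_nonneg (rate_pos L μ 0).le _
  have hqψ := rate_pow_mul_sqrt_le (L := L) (μ := μ) hψ0 hε (hk 0) hT0
  set q := rate L μ 0 ^ T 0
  set e := √hi * (c * η) with he
  have he0 : 0 ≤ e := by positivity
  have hNe : √N * e ≤ 4 / 10 * √ε := by
    have : √N * e = √(N * hi) * (4 ^ k * (δ * P * (2 * (√N * κ * g * σ)))) +
        √(N * hi) * (4 ^ k * (δ * P * (2 * ‖xstar‖))) := by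
      rw [Real.sqrt_mul hN0, he, hc, hη]; ring
    rw [this]
    linarith
  set S := ∑ j, √(Q.pot xstar μ j z) with hS
  have hS0 : 0 ≤ S := Finset.sum_nonneg fun _ _ => Real.sqrt_nonneg _
  have hS' : S ≤ √N * √ψ := by
    rw [← Real.sqrt_mul hN0]
    apply Real.le_sqrt_of_sq_le
    refine sq_sum_le_card_mul_sum_sq.trans ?_
    simp only [Finset.card_univ, Fintype.card_fin, Real.sq_sqrt (hpot _ z)]
    gcongr
  -- Squaring and summing over the blocks gives the bound `(q √ψ + √N e)²`, at most `1.4² ε`.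
  have hfin : ∀ j, Q.pot xstar μ j (acbsls agd L μ T 0 z) ≤
      q ^ 2 * Q.pot xstar μ j z + 2 * q * e * √(Q.pot xstar μ j z) + e ^ 2 := by
    intro j
    have h := hb.pot_high j (Fin.zero_le j)
    have h' : √(Q.pot xstar μ j (acbsls agd L μ T 0 z)) ≤ q * √(Q.pot xstar μ j z) + e := by
      refine h.trans ?_
      rw [he]
      gcongr
      exact hA.le_hi j
    have := (Real.sqrt_le_left (by positivity)).1 h'
    rw [add_sq, mul_pow, Real.sq_sqrt (hpot j z)] at this
    linarith
  have hsε : √ε ^ 2 = ε := Real.sq_sqrt hε.le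
  calc ∑ j, Q.pot xstar μ j (acbsls agd L μ T 0 z)
      ≤ ∑ j, (q ^ 2 * Q.pot xstar μ j z + 2 * q * e * √(Q.pot xstar μ j z) + e ^ 2) :=
        Finset.sum_le_sum fun j _ => hfin j
    _ = q ^ 2 * ∑ j, Q.pot xstar μ j z + 2 * q * e * S + N * e ^ 2 := by
        rw [Finset.sum_add_distrib, Finset.sum_add_distrib, ← Finset.mul_sum, ← Finset.mul_sum]
        simp [hN, hS]
    _ ≤ q ^ 2 * √ψ ^ 2 + 2 * q * e * (√N * √ψ) + √N ^ 2 * e ^ 2 := by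
        rw [Real.sq_sqrt hψ0, Real.sq_sqrt hN0]
        gcongr
    _ = (q * √ψ + √N * e) ^ 2 := by ring
    _ ≤ (√ε + 4 / 10 * √ε) ^ 2 := by gcongr
    _ ≤ 3 * ε := by nlinarith

end MultiscaleProblem

/-! ### Floating-point rounding. -/

/-- With `e = Int.log 2 |t|` the grid spacing is `2 ^ (e + 1 - p)`, and half of it is `2⁻ᵖ 2 ^ e ≤
2⁻ᵖ |t|`. -/
lemma abs_roundBits_sub_le (p : ℕ) (t : ℝ) : |roundBits p t - t| ≤ ((2 : ℝ) ^ p)⁻¹ * |t| := by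
  rcases eq_or_ne t 0 with rfl | ht
  · simp [roundBits]
  have h1 := Int.zpow_log_le_self (b := 2) (by norm_num) (abs_pos.2 ht)
  rw [roundBits]
  set e := Int.log 2 |t|
  push_cast at h1
  have hs : (2 : ℝ) ^ ((p : ℤ) - 1 - e) * 2 ^ (e + 1 - (p : ℤ)) = 1 := by
    rw [← zpow_add₀ (by norm_num)]; ring_nf; simp
  have h2 : (round (t * 2 ^ ((p : ℤ) - 1 - e)) : ℝ) * 2 ^ (e + 1 - (p : ℤ)) - t =
      (round (t * 2 ^ ((p : ℤ) - 1 - e)) - t * 2 ^ ((p : ℤ) - 1 - e)) * 2 ^ (e + 1 - (p : ℤ)) := by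
    rw [sub_mul, mul_assoc t, hs, mul_one]
  have h3 := abs_sub_round (t * (2 : ℝ) ^ ((p : ℤ) - 1 - e))
  rw [abs_sub_comm] at h3
  rw [h2, abs_mul, abs_of_pos (by positivity : (0 : ℝ) < 2 ^ (e + 1 - (p : ℤ)))]
  calc _ ≤ 1 / 2 * (2 : ℝ) ^ (e + 1 - (p : ℤ)) := by gcongr
    _ = ((2 : ℝ) ^ p)⁻¹ * 2 ^ e := by
      rw [zpow_sub₀ (by norm_num), zpow_add₀ (by norm_num), zpow_natCast]
      field_simp
    _ ≤ _ := by gcongr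

lemma accurateAt_roundedAGD {d : ℕ} (p : ℕ) (f : Vec d → ℝ) (L μ : ℝ) :
    AccurateAt f ((2 : ℝ) ^ p)⁻¹ (roundedAGD p f) L μ := fun _ _ =>
  ⟨fun _ => abs_roundBits_sub_le p _, fun _ => abs_roundBits_sub_le p _⟩

lemma le_two_pow_of_logb_le {B : ℝ} (hB : 0 ≤ B) {p : ℕ} (h : Real.logb 2 B ≤ p) :
    B ≤ 2 ^ p := by
  -- `B = 0` does occur, for instance when `T 0 = 0`.
  rcases hB.eq_or_lt with rfl | hB
  · positivity
  · rw [Real.logb_le_iff_le_rpow (by norm_num) hB] at h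
    exact_mod_cast h

/-! ### Known parameters. -/

namespace MultiscaleProblem

variable {d m : ℕ} (Q : MultiscaleProblem d m) {xstar : Vec d}

lemma psi_eq_sum_pot (z : Vec d × Vec d) : Q.psi xstar z = ∑ i, Q.pot xstar Q.μ i z := rfl

lemma mul_sum_gap_sq_le {L μ : Fin m → ℝ} {lo hi : ℝ} (hA : Q.Admissible L μ lo hi)
    (hmin : IsMinOn Q.obj Set.univ xstar) (x : Vec d) :
    lo * ‖x - xstar‖ ^ 2 ≤ ∑ i, Q.pot xstar μ i (x, x) := by
  rw [← Q.sum_norm_block_sq, Finset.mul_sum]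
  apply Finset.sum_le_sum
  intro i _
  have h1 := hA.mul_gap_sq_le_err hmin i x
  have h2 : lo * Q.gap xstar i x ^ 2 ≤ μ i * Q.gap xstar i x ^ 2 := by
    gcongr; exact hA.lo_le i
  simp only [pot, gap] at *
  linarith

variable [NeZero m]

lemma le_lastScale (i : Fin m) : i ≤ lastScale m := by
  rw [Fin.le_def, lastScale]
  have := i.isLt
  simp only
  omega

lemma μ_zero_le (i : Fin m) : Q.μ 0 ≤ Q.μ i := by
  rcases (Fin.zero_le i).eq_or_lt with h | h
  · rw [h]
  · exact (Q.μ_le_L 0).trans (Q.L_lt_μ 0 i h).le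

lemma le_L_last (i : Fin m) : Q.L i ≤ Q.L (lastScale m) := by
  rcases (le_lastScale i).eq_or_lt with h | h
  · rw [← h]
  · exact (Q.L_lt_μ i _ h).le.trans (Q.μ_le_L _)

lemma admissible_self : Q.Admissible Q.L Q.μ (Q.μ 0) (Q.L (lastScale m)) where
  lo_pos := Q.μ_pos 0
  lo_le := Q.μ_zero_le
  le_μ _ := le_rfl
  le_L _ := le_rfl
  le_hi := Q.le_L_last
  L_le i j h := by linarith [Q.L_lt_μ i j h, Q.μ_pos j]

lemma one_le_globalCond : 1 ≤ Q.globalCond := Q.admissible_self.one_le_cond 0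

lemma psi_nonneg (hmin : IsMinOn Q.obj Set.univ xstar) (z : Vec d × Vec d) :
    0 ≤ Q.psi xstar z :=
  Finset.sum_nonneg fun i _ => Q.admissible_self.pot_nonneg hmin i z

lemma precGeneral_nonneg (z : Vec d × Vec d) (ε : ℝ)
    (T : Fin m → ℕ) : 0 ≤ Q.precGeneral xstar z ε T := by
  have := Q.one_le_globalCond
  exact mul_nonneg (by positivity) (le_max_of_le_left (by positivity))

lemma precZero_nonneg (hmin : IsMinOn Q.obj Set.univ xstar) {ε : ℝ} (hε : 0 < ε)
    (T : Fin m → ℕ) : 0 ≤ Q.precZero xstar ε T := by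
  have := Q.one_le_globalCond
  have := Q.psi_nonneg hmin (0, 0)
  unfold precZero
  positivity

theorem psi_acbsls_le (hmin : IsMinOn Q.obj Set.univ xstar) {ε : ℝ} (hε : 0 < ε)
    {T : Fin m → ℕ} {z : Vec d × Vec d} (hT : Q.IterBounds (Q.psi xstar z) ε T) {δ : ℝ}
    {agd : AGDRoutine d} (hδ : 0 < δ) (hagd : ∀ i, AccurateAt Q.obj δ agd (Q.L i) (Q.μ i))
    (hB : Q.precGeneral xstar z ε T ≤ δ⁻¹) :
    Q.psi xstar (acbsls agd Q.L Q.μ T 0 z) ≤ 3 * ε := by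
  rw [← mul_one δ⁻¹, le_inv_mul_iff₀ hδ, precGeneral] at hB
  have hP : 0 ≤ δ * ∏ i, (T i : ℝ) := by positivity
  rw [← mul_assoc] at hB
  have key : ∀ {a b : ℝ}, a ≤ b → δ * (∏ i, (T i : ℝ)) * b ≤ 1 → δ * (∏ i, (T i : ℝ)) * a ≤ 1 :=
    fun h h' => (mul_le_mul_of_nonneg_left h hP).trans h'
  have h1 := key (le_max_left _ _) hB
  have h2 := key ((le_max_left _ _).trans (le_max_right _ _)) hB
  have h3 := key ((le_max_right _ _).trans (le_max_right _ _)) hB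
  rw [← mul_div_assoc, ← mul_div_assoc, div_le_one hε] at h2 h3
  exact sum_pot_acbsls_le Q.admissible_self hmin hδ hagd hε le_rfl hT.1 hT.2 h1 h2 h3

/-- From `μ₁ ‖xstar‖² ≤ ψ(0,0)` the term `L_m κ ‖xstar‖²` is at most `κ² ψ(0,0)`; the term without
`ψ` is absorbed because `ψ(0,0)/ε ≥ 1`. -/
lemma precGeneral_le_precZero (hmin : IsMinOn Q.obj Set.univ xstar) {ε : ℝ} (hε : 0 < ε)
    (T : Fin m → ℕ) (hψ : ε ≤ Q.psi xstar (0, 0)) :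
    Q.precGeneral xstar (0, 0) ε T ≤ Q.precZero xstar ε T := by
  have hκ := Q.one_le_globalCond
  have hx := Q.mul_sum_gap_sq_le Q.admissible_self hmin 0
  rw [zero_sub, norm_neg, ← psi_eq_sum_pot] at hx
  have hμ := Q.μ_pos 0
  have hL : Q.L (lastScale m) = Q.globalCond * Q.μ 0 := by
    rw [globalCond, div_mul_cancel₀ _ hμ.ne']
  rw [precGeneral, precZero, hL]
  set κ := Q.globalCond
  set ψ := Q.psi xstar (0, 0)
  obtain ⟨k, hk⟩ : ∃ k, m = k + 1 := ⟨m - 1, by have := NeZero.pos m; omega⟩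
  have hm1 : (1 : ℝ) ≤ m := by rw [hk]; simp
  have hψε : 1 ≤ ψ / ε := (one_le_div hε).2 hψ
  have e : 4 * m * (∏ i, (T i : ℝ)) * (10 * κ ^ 2) ^ (2 * m - 1) * (ψ / ε) =
      (∏ i, (T i : ℝ)) * (4 * (m * (10 * κ ^ 2) ^ (2 * m - 1) * (ψ / ε))) := by ring
  rw [e]
  gcongr
  have hG : 0 ≤ (10 * κ ^ 2) ^ (2 * m - 1) := by positivity
  refine max_le ?_ (max_le ?_ ?_)
  · have : (10 * κ ^ 2) ^ (2 * m - 1) ≤ m * (10 * κ ^ 2) ^ (2 * m - 1) * (ψ / ε) := by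
      calc (10 * κ ^ 2) ^ (2 * m - 1) = 1 * (10 * κ ^ 2) ^ (2 * m - 1) * 1 := by ring
        _ ≤ _ := by gcongr
    linarith
  · have : 0 ≤ m * (10 * κ ^ 2) ^ (2 * m - 1) * (ψ / ε) := by positivity
    linarith
  · have h1 : 3 ^ (m + 1) * κ ^ 2 ≤ (10 * κ ^ 2) ^ (2 * m - 1) := by
      have e : 2 * (k + 1) - 1 = 2 * k + 1 := by omega
      rw [hk, e, pow_succ (10 * κ ^ 2), pow_mul, pow_succ 3 (k + 1), pow_succ 3 k]
      have h100 : (3 : ℝ) ^ k ≤ ((10 * κ ^ 2) ^ 2) ^ k := by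
        gcongr
        nlinarith [one_le_pow₀ (n := 2) hκ]
      calc (3 : ℝ) ^ k * 3 * 3 * κ ^ 2 = 3 ^ k * (9 * κ ^ 2) := by ring
        _ ≤ ((10 * κ ^ 2) ^ 2) ^ k * (10 * κ ^ 2) := by gcongr; norm_num
    calc 4 * 3 ^ (m + 1) * (m * (κ * Q.μ 0) * κ) * (‖xstar‖ ^ 2 / ε)
        = 4 * (m * (3 ^ (m + 1) * κ ^ 2) * (Q.μ 0 * ‖xstar‖ ^ 2 / ε)) := by ring
      _ ≤ _ := by gcongr

theorem min_psi_acbsls_le (hmin : IsMinOn Q.obj Set.univ xstar) {ε : ℝ} (hε : 0 < ε)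
    {T : Fin m → ℕ} (hT : Q.IterBounds (Q.psi xstar (0, 0)) ε T) {δ : ℝ}
    {agd : AGDRoutine d} (hδ : 0 < δ) (hagd : ∀ i, AccurateAt Q.obj δ agd (Q.L i) (Q.μ i))
    (hB : Q.precZero xstar ε T ≤ δ⁻¹) :
    min (Q.psi xstar (0, 0)) (Q.psi xstar (acbsls agd Q.L Q.μ T 0 (0, 0))) ≤ 3 * ε := by
  rcases le_total (Q.psi xstar (0, 0)) ε with h | h
  · exact min_le_of_left_le (by linarith)
  · exact min_le_of_right_le (Q.psi_acbsls_le hmin hε hT hδ hagd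
      ((Q.precGeneral_le_precZero hmin hε T h).trans hB))

end MultiscaleProblem

/-! ### Oracle programs and their query counts. -/

namespace OracleProgram

variable {d : ℕ}

/-- A procedure in continuation-passing style that computes `F` with `N` oracle calls. -/
def Computes (Φ : Vec d × Vec d → (Vec d × Vec d → OracleProgram (Vec d)) →
    OracleProgram (Vec d)) (F : AGDRoutine d → Vec d × Vec d → Vec d × Vec d) (N : ℕ) : Prop :=
  ∀ agd f z next, run agd f (Φ z next) = run agd f (next (F agd z)) ∧
    queries agd f (Φ z next) = queries agd f (next (F agd z)) + N

lemma exists_computes_iterate {F : AGDRoutine d → Vec d × Vec d → Vec d × Vec d} {N : ℕ}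
    (h : ∃ Φ, Computes Φ F N) (T : ℕ) : ∃ Φ, Computes Φ (fun agd => (F agd)^[T]) (T * N) := by
  obtain ⟨Φ, hΦ⟩ := h
  induction T with
  | zero => exact ⟨fun z next => next z, fun agd f z next => by simp⟩
  | succ T ih =>
    obtain ⟨Φ', hΦ'⟩ := ih
    refine ⟨fun z next => Φ z fun z' => Φ' z' next, fun agd f z next => ?_⟩
    have h1 := hΦ agd f z fun z' => Φ' z' next
    have h2 := hΦ' agd f (F agd z) next
    refine ⟨h1.1.trans h2.1, ?_⟩
    rw [h1.2, h2.2]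
    simp only [Function.iterate_succ_apply]
    ring

/-- A round makes one step and two inner calls. As the bound for an inner call is at least 1, which
needs `hT`, each level costs a factor three. -/
lemma exists_computes_acbsls {m : ℕ} (L μ : Fin m → ℝ) (T : Fin m → ℕ)
    (hT : ∀ i : Fin m, 0 < i.val → 1 ≤ T i) (k : ℕ) : ∀ i : Fin m, i.val + k + 1 = m →
      ∃ N ≤ 3 ^ k * ∏ j ∈ Finset.Ici i, T j,
        ∃ Φ, Computes Φ (fun agd z => acbsls (d := d) agd L μ T i z) N := by
  induction k with
  | zero =>
    intro i hi
    have hIci : Finset.Ici i = {i} := by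
      ext j
      simp only [Finset.mem_Ici, Finset.mem_singleton, Fin.le_def, Fin.ext_iff]
      omega
    refine ⟨T i * 1, by simp [hIci], ?_⟩
    have := exists_computes_iterate (d := d) (F := fun agd u => agd u.1 u.2 (L i) (μ i)) (N := 1)
      ⟨fun z next => agdStep z.1 z.2 (L i) (μ i) next, fun agd f z next => by
        simp [run, queries]⟩ (T i)
    convert this using 5 with Φ agd z
    rw [acbsls]
    congr 2
    ext1 u
    rw [dif_neg (by omega)]
  | succ k ih =>
    intro i hi
    have hlt : i.val + 1 < m := by omega
    set i' : Fin m := ⟨i.val + 1, hlt⟩ with hi'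
    obtain ⟨N, hN, Φ, hΦ⟩ := ih i' (by simp only [hi']; omega)
    have hIci : Finset.Ici i = insert i (Finset.Ici i') := by
      ext j
      simp only [Finset.mem_Ici, Finset.mem_insert, Fin.le_def, Fin.ext_iff, hi']
      omega
    have hni : i ∉ Finset.Ici i' := by simp [Fin.le_def, hi']
    have hpos : 0 < 3 ^ k * ∏ j ∈ Finset.Ici i', T j := by
      apply Nat.mul_pos (by positivity)
      apply Finset.prod_pos
      intro j hj
      refine hT j ?_
      simp only [Finset.mem_Ici, Fin.le_def, hi'] at hj
      omega
    refine ⟨T i * (1 + 2 * N), ?_, ?_⟩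
    · rw [hIci, Finset.prod_insert hni]
      calc T i * (1 + 2 * N) ≤ T i * (3 * (3 ^ k * ∏ j ∈ Finset.Ici i', T j)) :=
            Nat.mul_le_mul_left _ (by omega)
        _ = _ := by ring
    have := exists_computes_iterate (d := d) (N := 1 + 2 * N)
      (F := fun agd u => ((acbsls agd L μ T i' ((agd u.1 u.2 (L i) (μ i)).1,
        (agd u.1 u.2 (L i) (μ i)).1)).1, (acbsls agd L μ T i' ((agd u.1 u.2 (L i) (μ i)).2,
        (agd u.1 u.2 (L i) (μ i)).2)).2))
      ⟨fun z next => agdStep z.1 z.2 (L i) (μ i) fun w =>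
        Φ (w.1, w.1) fun r => Φ (w.2, w.2) fun s => next (r.1, s.2), fun agd f z next => by
        simp only [run, queries]
        rw [(hΦ agd f _ _).1, (hΦ agd f _ _).1, (hΦ agd f _ _).2, (hΦ agd f _ _).2]
        exact ⟨rfl, by ring⟩⟩ (T i)
    convert this using 5 with Φ agd z
    rw [acbsls]
    congr 2
    ext1 u
    rw [dif_pos hlt]

/-- Finitely many procedures can be combined so that the best of their outputs is found. -/
lemma exists_best {S : Type*} (f₀ : S → AGDRoutine d → Vec d) (N : ℕ) (l : List S)
    (h : ∀ s ∈ l, ∃ Φ : (Vec d → OracleProgram (Vec d)) → OracleProgram (Vec d),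
      ∀ agd f next, run agd f (Φ next) = run agd f (next (f₀ s agd)) ∧
        queries agd f (Φ next) ≤ queries agd f (next (f₀ s agd)) + N) :
    ∀ (x : Vec d) (a : ℝ), ∃ A : OracleProgram (Vec d), ∀ agd f, f x = a →
      f (run agd f A) ≤ a ∧ (∀ s ∈ l, f (run agd f A) ≤ f (f₀ s agd)) ∧
        queries agd f A ≤ l.length * (N + 1) := by
  induction l with
  | nil => exact fun x a => ⟨output x, fun agd f hx => by simp [run, queries, hx]⟩
  | cons s l ih =>
    obtain ⟨Φ, hΦ⟩ := h s (by simp)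
    have ih := ih fun s hs => h s (by simp [hs])
    choose A hA using ih
    intro x a
    -- The rest of the search is a family `A` indexed by the incumbent and its value, so a candidate
    -- costs its own calls and one evaluation.
    refine ⟨Φ fun y => value y fun b => if b ≤ a then A y b else A x a, fun agd f hx => ?_⟩
    have h1 := hΦ agd f fun y => value y fun b => if b ≤ a then A y b else A x a
    rw [h1.1]
    simp only [run, queries] at h1 ⊢
    have hlen : (s :: l).length * (N + 1) = l.length * (N + 1) + 1 + N := by
      simp; ring
    rw [hlen]
    by_cases hb : f (f₀ s agd) ≤ a
    · have h2 := hA (f₀ s agd) (f (f₀ s agd)) agd f rfl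
      simp only [hb, if_true] at h1 ⊢
      refine ⟨h2.1.trans hb, ?_, by omega⟩
      simpa using ⟨h2.1, h2.2.1⟩
    · have h2 := hA x a agd f hx
      simp only [hb, if_false] at h1 ⊢
      refine ⟨h2.1, ?_, by omega⟩
      simpa using ⟨h2.1.trans (not_le.1 hb).le, h2.2.1⟩

end OracleProgram

/-! ### The grid of guessed parameters. -/

section Grid

variable {m : ℕ} [NeZero m]

/-- The logarithm of the ratio of the geometric grid of guessed parameters. -/
noncomputable def gridStep (m : ℕ) : ℝ := Real.log 2 / (2 * m)

/-- Indices for the grid of guessed parameters. -/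
abbrev GridIndex (m : ℕ) [NeZero m] (K : ℕ) : Type :=
  ({i : Fin m // i ≠ 0 ∧ i ≠ lastScale m} → Fin (K + 1)) ×
    ({i : Fin m // i ≠ lastScale m} → Fin (K + 1))

/-- The guessed smoothness constants. -/
noncomputable def gridL (hi : ℝ) {K : ℕ} (g : GridIndex m K) (i : Fin m) : ℝ :=
  if h : i ≠ lastScale m then hi * Real.exp (-((g.2 ⟨i, h⟩ : ℕ) * gridStep m)) else hi

/-- The guessed strong convexity constants, except for the last one. -/
noncomputable def gridBase (lo : ℝ) {K : ℕ} (g : GridIndex m K) (i : Fin m) : ℝ :=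
  if h : i ≠ 0 ∧ i ≠ lastScale m then lo * Real.exp ((g.1 ⟨i, h⟩ : ℕ) * gridStep m) else lo

/-- The guessed product of all condition numbers but the last one. -/
noncomputable def gridProd (lo hi : ℝ) {K : ℕ} (g : GridIndex m K) : ℝ :=
  ∏ i ∈ Finset.univ.erase (lastScale m), gridL hi g i / gridBase lo g i

/-- The guessed strong convexity constants; the last one is determined by the others and by the
product of the condition numbers. -/
noncomputable def gridμ (lo hi π : ℝ) {K : ℕ} (g : GridIndex m K) (i : Fin m) : ℝ :=
  if i = lastScale m then max lo (hi * gridProd lo hi g * Real.exp (gridStep m) / (2 * π))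
  else gridBase lo g i

lemma gridStep_pos : 0 < gridStep m := by
  have : (0 : ℝ) < m := by exact_mod_cast NeZero.pos m
  have := Real.log_pos one_lt_two
  unfold gridStep
  positivity

lemma exp_mul_gridStep_le {k : ℕ} (hk : k ≤ 2 * m) : Real.exp (k * gridStep m) ≤ 2 := by
  have hm : (0 : ℝ) < m := by exact_mod_cast NeZero.pos m
  have hk' : (k : ℝ) ≤ 2 * m := by exact_mod_cast hk
  calc Real.exp (k * gridStep m) ≤ Real.exp (2 * m * gridStep m) := by
        have := gridStep_pos (m := m); gcongr
    _ = 2 := by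
        rw [gridStep, mul_div_cancel₀ _ (by positivity), Real.exp_log two_pos]

/-- The first `μ` and the last `L` are known and the last `μ` is computed, leaving `(m - 2) + (m -
1)` free parameters. For `m = 1` there are none, in accordance with truncated subtraction. -/
lemma card_gridIndex_le (K : ℕ) :
    Fintype.card (GridIndex m K) ≤ (K + 1) ^ (2 * m - 3) := by
  rw [Fintype.card_prod, Fintype.card_fun, Fintype.card_fun, Fintype.card_fin, ← pow_add]
  apply Nat.pow_le_pow_right (by omega)
  have h2 : Fintype.card {i : Fin m // i ≠ lastScale m} = m - 1 := by
    simp [Fintype.card_subtype_compl]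
  have h1 : Fintype.card {i : Fin m // i ≠ 0 ∧ i ≠ lastScale m} = m - 2 := by
    rw [Fintype.card_subtype]
    have e : (Finset.univ.filter fun i : Fin m => i ≠ 0 ∧ i ≠ lastScale m) =
        (Finset.univ.erase 0).erase (lastScale m) := by
      ext i; simp [and_comm]
    rw [e]
    rcases eq_or_ne m 1 with rfl | hm
    · rfl
    · have hne : lastScale m ≠ 0 := by
        have := NeZero.pos m
        rw [Ne, Fin.ext_iff, lastScale, Fin.val_zero]
        simp only
        omega
      rw [Finset.card_erase_of_mem (by simp [hne]), Finset.card_erase_of_mem (by simp)]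
      simp
      omega
  rw [h1, h2]
  have := NeZero.pos m
  omega

variable {lo hi π : ℝ} {K : ℕ}

lemma gridL_last (g : GridIndex m K) : gridL hi g (lastScale m) = hi := by simp [gridL]

lemma gridL_pos (h : 0 < hi) (g : GridIndex m K) (i : Fin m) : 0 < gridL hi g i := by
  unfold gridL; split_ifs <;> positivity

lemma gridL_le (h : 0 < hi) (g : GridIndex m K) (i : Fin m) : gridL hi g i ≤ hi := by
  unfold gridL
  split_ifs
  · have := gridStep_pos (m := m)
    exact mul_le_of_le_one_right h.le (Real.exp_le_one_iff.2 (neg_nonpos.2 (by positivity)))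
  · exact le_rfl

lemma le_gridBase (h : 0 < lo) (g : GridIndex m K) (i : Fin m) : lo ≤ gridBase lo g i := by
  unfold gridBase
  split_ifs
  · have := gridStep_pos (m := m)
    exact le_mul_of_one_le_right h.le (Real.one_le_exp (by positivity))
  · exact le_rfl

lemma le_gridμ (h : 0 < lo) (g : GridIndex m K) (i : Fin m) : lo ≤ gridμ lo hi π g i := by
  unfold gridμ
  split_ifs
  · exact le_max_left _ _
  · exact le_gridBase h g i

lemma gridProd_pos (hlo : 0 < lo) (hhi : 0 < hi) (g : GridIndex m K) : 0 < gridProd lo hi g :=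
  Finset.prod_pos fun i _ => div_pos (gridL_pos hhi g i) (hlo.trans_le (le_gridBase hlo g i))

/-- The formula for the last `μ` enforces this for every grid point, so that even wrong guesses are
affordable. -/
lemma prod_grid_le (hlo : 0 < lo) (hhi : 0 < hi) (hπ : 0 < π) (g : GridIndex m K) :
    ∏ i, gridL hi g i / gridμ lo hi π g i ≤ 2 * π := by
  have hq := gridProd_pos hlo hhi g
  have hh := gridStep_pos (m := m)
  rw [← Finset.mul_prod_erase _ _ (Finset.mem_univ (lastScale m)), gridL_last]
  have e : ∏ i ∈ Finset.univ.erase (lastScale m), gridL hi g i / gridμ lo hi π g i =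
      gridProd lo hi g := by
    apply Finset.prod_congr rfl
    intro i hi'
    rw [gridμ, if_neg (Finset.ne_of_mem_erase hi')]
  have h0 : hi * gridProd lo hi g * Real.exp (gridStep m) / (2 * π) ≤
      gridμ lo hi π g (lastScale m) := by simp [gridμ]
  have h1 : 1 ≤ Real.exp (gridStep m) := Real.one_le_exp hh.le
  rw [e, div_mul_eq_mul_div, div_le_iff₀ (hlo.trans_le (le_gridμ hlo g _))]
  calc hi * gridProd lo hi g ≤ hi * gridProd lo hi g * Real.exp (gridStep m) :=
        le_mul_of_one_le_right (by positivity) h1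
    _ = 2 * π * (hi * gridProd lo hi g * Real.exp (gridStep m) / (2 * π)) := by field_simp
    _ ≤ _ := by gcongr

/-- A number in an interval is approximated from below on a geometric grid. -/
lemma exists_grid_exponent {lo t hi h : ℝ} (hlo : 0 < lo) (h1 : lo ≤ t) (h2 : t ≤ hi)
    (hh : 0 < h) : ∃ k : ℕ, k < ⌊Real.log (hi / lo) / h⌋₊ + 1 ∧
      lo * Real.exp (k * h) ≤ t ∧ t ≤ lo * Real.exp (k * h) * Real.exp h := by
  have ht : 0 < t := hlo.trans_le h1
  have hl : 0 ≤ Real.log (t / lo) := Real.log_nonneg ((one_le_div hlo).2 h1)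
  refine ⟨⌊Real.log (t / lo) / h⌋₊, ?_, ?_, ?_⟩
  · rw [Nat.lt_succ_iff]
    apply Nat.floor_le_floor
    gcongr
  · have := (le_div_iff₀ hh).1 (Nat.floor_le (div_nonneg hl hh.le))
    rw [← le_div_iff₀' hlo]
    exact (Real.le_log_iff_exp_le (by positivity)).1 this
  · have := (div_lt_iff₀ hh).1 (Nat.lt_floor_add_one (Real.log (t / lo) / h))
    rw [mul_assoc, ← Real.exp_add, ← div_le_iff₀' hlo]
    refine (Real.log_le_iff_le_exp (by positivity)).1 (this.le.trans_eq ?_)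
    ring

/-- Round each `L` up and each `μ` down on a grid of ratio `E = 2 ^ (1/(2m))`. This overestimates
the product of the first `m - 1` condition numbers by at most `E ^ (2(m-1))`, so the formula for the
last `μ` gives between `E/2` and 1 times its true value. Separation up to two then holds there, and
at the other scales because `E² ≤ 2`. -/
lemma exists_admissible_grid {d : ℕ} (Q : MultiscaleProblem d m) :
    ∃ g : GridIndex m ⌊Real.log (Q.L (lastScale m) / Q.μ 0) / gridStep m⌋₊,
      Q.Admissible (gridL (Q.L (lastScale m)) g)
        (gridμ (Q.μ 0) (Q.L (lastScale m)) (∏ i, Q.cond i) g) (Q.μ 0) (Q.L (lastScale m)) := by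
  have hh := gridStep_pos (m := m)
  have hlo := Q.μ_pos 0
  set lo := Q.μ 0 with hlodef
  set hi := Q.L (lastScale m) with hhidef
  have hhi : 0 < hi := Q.L_pos _
  set K := ⌊Real.log (hi / lo) / gridStep m⌋₊
  set E := Real.exp (gridStep m) with hE
  have hE1 : 1 ≤ E := Real.one_le_exp hh.le
  have hEpow : ∀ k ≤ 2 * m, E ^ k ≤ 2 := fun k hk => by
    rw [hE, ← Real.exp_nat_mul]; exact exp_mul_gridStep_le hk
  have hm := NeZero.pos m
  have hμhi : ∀ i, Q.μ i ≤ hi := fun i => (Q.μ_le_L i).trans (Q.le_L_last i)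
  choose a ha using fun i => exists_grid_exponent hlo (Q.μ_zero_le i) (hμhi i) hh
  -- Rounding `lo * hi / L i` down amounts to rounding `L i` up on the grid descending from `hi`.
  choose b hb using fun i => exists_grid_exponent (lo := lo) (t := lo * hi / Q.L i) (hi := hi) hlo
    (by rw [le_div_iff₀ (Q.L_pos i)]; exact mul_le_mul_of_nonneg_left (Q.le_L_last i) hlo.le)
    (by
      rw [div_le_iff₀ (Q.L_pos i), mul_comm]
      exact mul_le_mul_of_nonneg_left ((Q.μ_zero_le i).trans (Q.μ_le_L i)) hhi.le) hh
  let g : GridIndex m K := (fun i => ⟨a i, (ha i).1⟩, fun i => ⟨b i, (hb i).1⟩)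
  have hL : ∀ i, Q.L i ≤ gridL hi g i ∧ gridL hi g i ≤ E * Q.L i := by
    intro i
    have hLi := Q.L_pos i
    unfold gridL
    split_ifs with h
    · have h1 := (hb i).2.1
      have h2 := (hb i).2.2
      rw [le_div_iff₀ hLi] at h1
      rw [div_le_iff₀ hLi] at h2
      have h1' : Real.exp (b i * gridStep m) * Q.L i ≤ hi :=
        le_of_mul_le_mul_left (by linarith) hlo
      have h2' : hi ≤ Real.exp (b i * gridStep m) * E * Q.L i :=
        le_of_mul_le_mul_left (by linarith) hlo
      simp only [g]
      rw [Real.exp_neg, ← div_eq_mul_inv]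
      constructor
      · rw [le_div_iff₀ (Real.exp_pos _)]; linarith
      · rw [div_le_iff₀ (Real.exp_pos _)]; linarith
    · rw [not_ne_iff] at h
      rw [h]
      exact ⟨le_rfl, le_mul_of_one_le_left hhi.le hE1⟩
  have hB : ∀ i, i ≠ lastScale m → gridBase lo g i ≤ Q.μ i ∧ Q.μ i ≤ E * gridBase lo g i := by
    intro i hi'
    unfold gridBase
    split_ifs with h
    · exact ⟨(ha i).2.1, by rw [mul_comm]; exact (ha i).2.2⟩
    · have : i = 0 := by
        by_contra h0
        exact h ⟨h0, hi'⟩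
      rw [this]
      exact ⟨le_rfl, le_mul_of_one_le_left hlo.le hE1⟩
  set q := gridProd lo hi g with hq
  set s := ∏ i ∈ Finset.univ.erase (lastScale m), Q.cond i with hs
  have hcond : ∀ i, 0 < Q.cond i := fun i => div_pos (Q.L_pos i) (Q.μ_pos i)
  have hs0 : 0 < s := Finset.prod_pos fun i _ => hcond i
  have hsq : s ≤ q := by
    apply Finset.prod_le_prod
    · exact fun i _ => (hcond i).le
    · intro i hi'
      have := hlo.trans_le (le_gridBase hlo g i)
      have h1 := (hL i).1
      have h2 := (hB i (Finset.ne_of_mem_erase hi')).1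
      have := (Q.L_pos i).le
      rw [MultiscaleProblem.cond]
      gcongr
      exact this.trans h1
  have hqs : q ≤ E ^ (2 * (m - 1)) * s := by
    calc q ≤ ∏ i ∈ Finset.univ.erase (lastScale m), E ^ 2 * Q.cond i := by
          apply Finset.prod_le_prod
          · exact fun i _ => (div_pos (gridL_pos hhi g i)
              (hlo.trans_le (le_gridBase hlo g i))).le
          · intro i hi'
            have h0 := hlo.trans_le (le_gridBase hlo g i)
            have h1 := (hL i).2
            have h2 := (hB i (Finset.ne_of_mem_erase hi')).2
            have h3 := Q.μ_pos i
            have h4 := Q.L_pos i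
            rw [MultiscaleProblem.cond, div_le_iff₀ h0]
            calc gridL hi g i ≤ E * Q.L i := h1
              _ = E * Q.L i / Q.μ i * Q.μ i := by field_simp
              _ ≤ E * Q.L i / Q.μ i * (E * gridBase lo g i) := by gcongr
              _ = _ := by ring
      _ = E ^ (2 * (m - 1)) * s := by
          rw [Finset.prod_mul_distrib, Finset.prod_const, ← pow_mul,
            Finset.card_erase_of_mem (Finset.mem_univ _)]
          simp [hs]
  set π := ∏ i, Q.cond i with hπ
  have hπs : π = hi / Q.μ (lastScale m) * s := by
    rw [hπ, hs, ← Finset.mul_prod_erase _ _ (Finset.mem_univ (lastScale m)), MultiscaleProblem.cond]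
  have hμm := Q.μ_pos (lastScale m)
  set M := Q.μ (lastScale m) with hM
  have hπ0 : 0 < π := by rw [hπs]; positivity
  have hMe : hi * q * E / (2 * π) = q * E / (2 * s) * M := by
    rw [hπs]; field_simp
  have hM1 : hi * q * E / (2 * π) ≤ M := by
    rw [hMe]
    refine mul_le_of_le_one_left hμm.le ?_
    rw [div_le_one (by positivity)]
    calc q * E ≤ E ^ (2 * (m - 1)) * s * E := by gcongr
      _ = E ^ (2 * (m - 1) + 1) * s := by ring
      _ ≤ 2 * s := by gcongr; exact hEpow _ (by omega)
  have hM2 : E * M ≤ 2 * (hi * q * E / (2 * π)) := by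
    rw [hMe]
    calc E * M = 2 * (s * E / (2 * s) * M) := by field_simp
      _ ≤ _ := by gcongr
  refine ⟨g, hlo, le_gridμ hlo g, fun i => ?_, fun i => (hL i).1, gridL_le hhi g, ?_⟩
  · unfold gridμ
    split_ifs with h
    · rw [h]
      exact max_le (Q.μ_zero_le _) hM1
    · exact (hB i h).1
  · intro i j hij
    have h1 := (hL i).2.trans (mul_le_mul_of_nonneg_left (Q.L_lt_μ i j hij).le (by linarith))
    refine h1.trans ?_
    unfold gridμ
    split_ifs with h
    · rw [h]
      exact hM2.trans (by gcongr; exact le_max_right _ _)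
    · have h2 := (hB j h).2
      have h3 := hlo.trans_le (le_gridBase hlo g j)
      calc E * Q.μ j ≤ E * (E * gridBase lo g j) := by gcongr
        _ = E ^ 2 * gridBase lo g j := by ring
        _ ≤ 2 * gridBase lo g j := by gcongr; exact hEpow 2 (by omega)

lemma card_gridIndex_le_log (hlo : 0 < lo) (hhi : lo ≤ hi) :
    (Fintype.card (GridIndex m ⌊Real.log (hi / lo) / gridStep m⌋₊) : ℝ) ≤
      (1 / gridStep m) ^ (2 * m - 3) * (1 + Real.log (hi / lo)) ^ (2 * m - 3) := by
  have hh := gridStep_pos (m := m)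
  have hl : 0 ≤ Real.log (hi / lo) := Real.log_nonneg ((one_le_div hlo).2 hhi)
  have hm : (1 : ℝ) ≤ m := by exact_mod_cast NeZero.pos m
  have h1 : gridStep m ≤ 1 := by
    rw [gridStep, div_le_one (by positivity)]
    linarith [Real.log_two_lt_d9]
  rw [← mul_pow]
  refine (Nat.cast_le.2 (card_gridIndex_le _)).trans ?_
  push_cast
  gcongr
  have h2 := Nat.floor_le (div_nonneg hl hh.le)
  have h3 : 1 ≤ 1 / gridStep m := (one_le_div hh).2 h1
  calc _ ≤ Real.log (hi / lo) / gridStep m + 1 / gridStep m := add_le_add h2 h3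
    _ = _ := by ring

end Grid

/-! ### Runs with guessed parameters and the search among them. -/

/-- Iteration counts for guessed parameters. -/
noncomputable def guessIters {m : ℕ} [NeZero m] (L μ : Fin m → ℝ) (κ ρ : ℝ) (i : Fin m) : ℕ :=
  if i = 0 then ⌈√(L i / μ i) * (1 + max 0 (Real.log ρ))⌉₊
  else ⌈√(L i / μ i) * (Real.log (4 * κ ^ 4) + 1)⌉₊

/-- A ceiling adds at most 1, hence at most `√(L i / μ i)`, which the constants 2 and 4 per factor
absorb. -/
lemma prod_guessIters_le {m : ℕ} [NeZero m] {L μ : Fin m → ℝ} {κ π ρ : ℝ} (hμ : ∀ i, 0 < μ i)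
    (hμL : ∀ i, μ i ≤ L i) (hκ : 1 ≤ κ) (hπ : ∏ i, L i / μ i ≤ 2 * π) :
    ∏ i, (guessIters L μ κ ρ i : ℝ) ≤ 4 ^ m * acRate m π κ ρ := by
  have hl : 0 ≤ Real.log κ := Real.log_nonneg hκ
  set r := max 0 (Real.log ρ)
  have hr : 0 ≤ r := le_max_left _ _
  have hk : ∀ i, 1 ≤ L i / μ i := fun i => (one_le_div (hμ i)).2 (hμL i)
  have hlog : Real.log (4 * κ ^ 4) + 1 ≤ 3 + 4 * Real.log κ := by
    rw [Real.log_mul (by norm_num) (by positivity), Real.log_pow,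
      show (4 : ℝ) = 2 ^ 2 by norm_num, Real.log_pow]
    push_cast
    linarith [Real.log_two_lt_d9]
  have hlog0 : 0 ≤ Real.log (4 * κ ^ 4) :=
    Real.log_nonneg (by nlinarith [one_le_pow₀ (n := 4) hκ])
  have hle : ∀ i, (guessIters L μ κ ρ i : ℝ) ≤
      √(L i / μ i) * (if i = 0 then 2 * (1 + r) else 4 * (1 + Real.log κ)) := by
    intro i
    have hs : 1 ≤ √(L i / μ i) := Real.one_le_sqrt.2 (hk i)
    unfold guessIters
    split_ifs
    · refine (Nat.ceil_lt_add_one (by positivity)).le.trans ?_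
      nlinarith
    · refine (Nat.ceil_lt_add_one (by positivity)).le.trans ?_
      nlinarith
  have hsqrt : ∏ i, √(L i / μ i) ≤ 2 * √π := by
    have h0 : 0 ≤ 2 * π := le_trans (Finset.prod_nonneg fun i _ => zero_le_one.trans (hk i)) hπ
    have : ∏ i, √(L i / μ i) = √(∏ i, L i / μ i) := by
      symm
      apply Real.sqrt_eq_iff_mul_self_eq (Finset.prod_nonneg fun i _ => zero_le_one.trans (hk i))
        (Finset.prod_nonneg fun i _ => Real.sqrt_nonneg _) |>.2
      rw [← Finset.prod_mul_distrib]
      exact Finset.prod_congr rfl fun i _ =>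
        (Real.mul_self_sqrt (zero_le_one.trans (hk i))).symm
    rw [this]
    apply Real.sqrt_le_iff.2 ⟨by positivity, ?_⟩
    rw [mul_pow, Real.sq_sqrt (by linarith)]
    linarith
  obtain ⟨k, rfl⟩ : ∃ k, m = k + 1 := ⟨m - 1, by have := NeZero.pos m; omega⟩
  calc ∏ i, (guessIters L μ κ ρ i : ℝ)
      ≤ ∏ i, √(L i / μ i) * (if i = 0 then 2 * (1 + r) else 4 * (1 + Real.log κ)) :=
        Finset.prod_le_prod (fun _ _ => Nat.cast_nonneg _) fun i _ => hle i
    _ = (∏ i, √(L i / μ i)) * (2 * (1 + r) * (4 * (1 + Real.log κ)) ^ k) := by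
        rw [Finset.prod_mul_distrib, Fin.prod_univ_succ fun i : Fin (k + 1) =>
          if i = 0 then 2 * (1 + r) else 4 * (1 + Real.log κ)]
        simp [Fin.succ_ne_zero]
    _ ≤ 2 * √π * (2 * (1 + r) * (4 * (1 + Real.log κ)) ^ k) := by gcongr
    _ = 4 ^ (k + 1) * acRate (k + 1) π κ ρ := by
        simp only [acRate, mul_pow, Nat.add_sub_cancel]
        ring

namespace MultiscaleProblem

variable {d m : ℕ} {Q : MultiscaleProblem d m} {xstar : Vec d}

/-- Strong convexity bounds each residual at `x` by the error at `x`. Together with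
`obj_sub_le_sum_pot`, this lets values of `f` alone select among the guesses. -/
lemma psi_self_le (hmin : IsMinOn Q.obj Set.univ xstar) (x : Vec d) :
    Q.psi xstar (x, x) ≤ 2 * (Q.obj x - Q.obj xstar) := by
  rw [← Q.sum_err hmin, Finset.mul_sum]
  apply Finset.sum_le_sum
  intro i _
  have := Q.mul_gap_sq_le_err hmin i x
  simp only [res, gap] at *
  linarith

lemma obj_sub_le_sum_pot {L μ : Fin m → ℝ} {lo hi : ℝ} (hA : Q.Admissible L μ lo hi)
    (hmin : IsMinOn Q.obj Set.univ xstar) (z : Vec d × Vec d) :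
    Q.obj z.1 - Q.obj xstar ≤ ∑ i, Q.pot xstar μ i z := by
  rw [← Q.sum_err hmin]
  apply Finset.sum_le_sum
  intro i _
  have := hA.μ_pos i
  rw [pot]
  exact le_add_of_nonneg_right (by positivity)

lemma sum_pot_le_psi {L μ : Fin m → ℝ} {lo hi : ℝ} (hA : Q.Admissible L μ lo hi)
    (z : Vec d × Vec d) : ∑ i, Q.pot xstar μ i z ≤ Q.psi xstar z := by
  rw [psi_eq_sum_pot]
  apply Finset.sum_le_sum
  intro i _
  unfold pot
  gcongr
  exact hA.le_μ i

/-- A sufficient constant for the precision of the search with unknown parameters. -/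
noncomputable def searchPrec (m : ℕ) : ℝ := 4 ^ m * (m * (4 * 10 ^ (2 * m - 1) + 8 * 3 ^ (m + 1)))

/-- The target is `ε / 2` because `psi_self_le` loses a factor two. -/
lemma sum_pot_acbsls_guess_le [NeZero m] {L μ : Fin m → ℝ} {lo hi π ε Ψ : ℝ}
    (hA : Q.Admissible L μ lo hi) (hmin : IsMinOn Q.obj Set.univ xstar) {agd : AGDRoutine d}
    {δ : ℝ} (hδ : 0 < δ) (hagd : ∀ i, AccurateAt Q.obj δ agd (L i) (μ i))
    (hπ : ∏ i, L i / μ i ≤ 2 * π) {z : Vec d × Vec d} (hε : 0 < ε) (hψ : Q.psi xstar z ≤ Ψ)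
    (hΨ : ε ≤ Ψ)
    (h1 : δ * (searchPrec m * acRate m π (hi / lo) (Ψ / ε) *
      ((hi / lo) ^ (2 * (2 * m - 1)) * (Ψ / ε))) ≤ 1)
    (h2 : δ * (searchPrec m * acRate m π (hi / lo) (Ψ / ε) *
      (hi * (hi / lo) * (‖xstar‖ ^ 2 / ε))) ≤ 1) :
    ∑ i, Q.pot xstar μ i (acbsls agd L μ (guessIters L μ (hi / lo) (Ψ / ε)) 0 z) ≤
      3 * (ε / 2) := by
  have hκ := hA.one_le_cond 0
  have hP := prod_guessIters_le (ρ := Ψ / ε) hA.μ_pos hA.μ_le_L hκ hπ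
  have hhi : 0 ≤ hi := (hA.L_pos 0).le.trans (hA.le_hi 0)
  have hΨ0 : 0 < Ψ := hε.trans_le hΨ
  have hΨε : 1 ≤ Ψ / ε := (one_le_div hε).2 hΨ
  have hm : (1 : ℝ) ≤ m := by exact_mod_cast NeZero.pos m
  set κ := hi / lo
  set R := acRate m π κ (Ψ / ε)
  set T := guessIters L μ κ (Ψ / ε)
  have hR : 0 ≤ R := by
    have h0 : 0 ≤ ∏ i, (T i : ℝ) := by positivity
    exact nonneg_of_mul_nonneg_right (h0.trans hP) (by positivity)
  have hpow : (10 * κ ^ 2) ^ (2 * m - 1) = 10 ^ (2 * m - 1) * κ ^ (2 * (2 * m - 1)) := by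
    rw [mul_pow, ← pow_mul]
  set G := (10 : ℝ) ^ (2 * m - 1)
  have hG : 0 < G := by positivity
  have hH : (0 : ℝ) < 3 ^ (m + 1) := by positivity
  set H := (3 : ℝ) ^ (m + 1)
  set W := κ ^ (2 * (2 * m - 1))
  have hW : 0 < W := by positivity
  have hmG : G ≤ m * G := le_mul_of_one_le_left hG.le hm
  have hmH : 0 ≤ m * H := by positivity
  rw [searchPrec] at h1 h2
  have key : ∀ {a c : ℝ}, 0 ≤ a → 0 ≤ c →
      a ≤ m * (4 * G + 8 * H) →
      δ * (4 ^ m * (m * (4 * G + 8 * H)) * R * c) ≤ 1 → δ * (∏ i, (T i : ℝ)) * (a * c) ≤ 1 := by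
    intro a c ha hc hab h
    refine le_trans ?_ h
    calc δ * (∏ i, (T i : ℝ)) * (a * c) ≤ δ * (4 ^ m * R) * (m * (4 * G + 8 * H) * c) := by gcongr
      _ = _ := by ring
  have k1 := key (a := 4 * (m * G)) (by positivity) (by positivity) (by linarith) h1
  have k2 := key (a := 8 * (m * H)) (by positivity) (by positivity)
    (by nlinarith) h2
  have hδT : 0 ≤ δ * ∏ i, (T i : ℝ) := by positivity
  refine sum_pot_acbsls_le hA hmin hδ hagd (half_pos hε) ((sum_pot_le_psi hA z).trans hψ)
    ?_ ?_ ?_ ?_ ?_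
  -- The summand 1 in `guessIters` pays for the `log 2` caused by halving `ε`.
  · simp only [T, guessIters, if_true]
    refine le_trans ?_ (Nat.le_ceil _)
    gcongr
    rw [show Ψ / (ε / 2) = 2 * (Ψ / ε) by field_simp, Real.log_mul (by norm_num) (by positivity)]
    linarith [Real.log_two_lt_d9, le_max_right 0 (Real.log (Ψ / ε))]
  · intro i hi'
    simp only [T, guessIters, if_neg hi']
    exact Nat.le_ceil _
  · rw [hpow]
    refine le_trans (mul_le_mul_of_nonneg_left ?_ hδT) k1
    calc 2 * (G * W) = 2 * G * (W * 1) := by ring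
      _ ≤ 4 * (m * G) * (W * (Ψ / ε)) := by gcongr; linarith
  · rw [hpow]
    have := mul_le_mul_of_nonneg_right k1 (half_pos hε).le
    rw [one_mul] at this
    refine le_trans (le_of_eq ?_) this
    field_simp
    ring
  · have := mul_le_mul_of_nonneg_right k2 (half_pos hε).le
    rw [one_mul] at this
    refine le_trans (le_of_eq ?_) this
    field_simp
    ring

end MultiscaleProblem

open MultiscaleProblem

/-- The constant in the bounds for the search with unknown parameters. -/
noncomputable def searchConst (m : ℕ) : ℝ :=
  searchPrec m + 2 * 12 ^ m * (1 / gridStep m) ^ (2 * m - 3) + 1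

/-- Only guesses with `μ ≤ L` are run, as the bound on their iteration counts needs this. In `12 ^
m`, `3 ^ m` comes from the query count and `4 ^ m` from `prod_guessIters_le`. -/
lemma exists_search_program {d m : ℕ} [NeZero m] {lo hi π ε Ψ : ℝ} (hlo : 0 < lo) (hhi : lo ≤ hi)
    (hπ : 1 ≤ π) (z : Vec d × Vec d) :
    ∃ A : OracleProgram (Vec d), ∀ (agd : AGDRoutine d) (f : Vec d → ℝ),
      (∀ g : GridIndex m ⌊Real.log (hi / lo) / gridStep m⌋₊,
        (∀ i, gridμ lo hi π g i ≤ gridL hi g i) →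
        f (A.run agd f) ≤ f (acbsls agd (gridL hi g) (gridμ lo hi π g)
          (guessIters (gridL hi g) (gridμ lo hi π g) (hi / lo) (Ψ / ε)) 0 z).1) ∧
      (A.queries agd f : ℝ) ≤ (2 * 12 ^ m * (1 / gridStep m) ^ (2 * m - 3) + 1) *
        acRate m π (hi / lo) (Ψ / ε) * (1 + Real.log (hi / lo)) ^ (2 * m - 3) := by
  classical
  have hκ : 1 ≤ hi / lo := (one_le_div hlo).2 hhi
  have hl : 0 ≤ Real.log (hi / lo) := Real.log_nonneg hκ
  have hcard := card_gridIndex_le_log (m := m) hlo hhi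
  set κ := hi / lo
  have hR : 1 ≤ acRate m π κ (Ψ / ε) := by
    have h1 : 1 ≤ √π := Real.one_le_sqrt.2 hπ
    have h2 : 1 ≤ (1 + Real.log κ) ^ (m - 1) := one_le_pow₀ (by linarith)
    have h3 : 1 ≤ 1 + max 0 (Real.log (Ψ / ε)) := by linarith [le_max_left 0 (Real.log (Ψ / ε))]
    exact one_le_mul_of_one_le_of_one_le (one_le_mul_of_one_le_of_one_le h1 h2) h3
  set R := acRate m π κ (Ψ / ε)
  set K := ⌊Real.log κ / gridStep m⌋₊
  let T : GridIndex m K → Fin m → ℕ := fun g => guessIters (gridL hi g) (gridμ lo hi π g) κ (Ψ / ε)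
  let l : List (GridIndex m K) :=
    (Finset.univ.filter fun g => ∀ i, gridμ lo hi π g i ≤ gridL hi g i).toList
  set N := ⌊12 ^ m * R⌋₊ with hN
  obtain ⟨k, hk⟩ : ∃ k, m = k + 1 := ⟨m - 1, by have := NeZero.pos m; omega⟩
  have hl' : ∀ g ∈ l, ∃ Φ : (Vec d → OracleProgram (Vec d)) → OracleProgram (Vec d),
      ∀ (agd : AGDRoutine d) (f : Vec d → ℝ) next, OracleProgram.run agd f (Φ next) =
        OracleProgram.run agd f
          (next (acbsls agd (gridL hi g) (gridμ lo hi π g) (T g) 0 z).1) ∧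
        OracleProgram.queries agd f (Φ next) ≤ OracleProgram.queries agd f
          (next (acbsls agd (gridL hi g) (gridμ lo hi π g) (T g) 0 z).1) + N := by
    intro g hg
    simp only [l, Finset.mem_toList, Finset.mem_filter, Finset.mem_univ, true_and] at hg
    have hμ : ∀ i, 0 < gridμ lo hi π g i := fun i => hlo.trans_le (le_gridμ hlo g i)
    have hT : ∀ i : Fin m, 0 < i.val → 1 ≤ T g i := by
      intro i hi'
      have h0 : i ≠ 0 := by rintro rfl; simp at hi'
      simp only [T, guessIters, if_neg h0]
      apply Nat.one_le_ceil_iff.2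
      have h1 : 0 < gridL hi g i / gridμ lo hi π g i := div_pos ((hμ i).trans_le (hg i)) (hμ i)
      have h2 : 0 ≤ Real.log (4 * κ ^ 4) :=
        Real.log_nonneg (by nlinarith [one_le_pow₀ (n := 4) hκ])
      positivity
    obtain ⟨N', hN', Φ, hΦ⟩ := OracleProgram.exists_computes_acbsls (d := d) (gridL hi g)
      (gridμ lo hi π g) (T g) hT k 0 (by simp [hk])
    refine ⟨fun next => Φ z fun w => next w.1, fun agd f next => ?_⟩
    have h := hΦ agd f z fun w => next w.1
    refine ⟨h.1, h.2.le.trans (Nat.add_le_add_left (hN'.trans ?_) _)⟩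
    have hIci : Finset.Ici (0 : Fin m) = Finset.univ := by ext j; simp
    rw [hIci, hN]
    apply Nat.le_floor
    push_cast
    have hP := prod_guessIters_le (ρ := Ψ / ε) hμ hg hκ
      (prod_grid_le hlo (hlo.trans_le hhi) (by linarith) g)
    calc (3 : ℝ) ^ k * ∏ j, (T g j : ℝ) ≤ 3 ^ m * (4 ^ m * R) := by
          gcongr
          · norm_num
          · omega
      _ = 12 ^ m * R := by rw [← mul_assoc, ← mul_pow]; norm_num
  choose A hA using OracleProgram.exists_best _ N l hl' z.1
  refine ⟨OracleProgram.value z.1 A, fun agd f => ?_⟩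
  have h := hA (f z.1) agd f rfl
  simp only [OracleProgram.run, OracleProgram.queries]
  refine ⟨fun g hg => h.2.1 g (by simpa [l] using hg), ?_⟩
  have hlen : l.length ≤ Fintype.card (GridIndex m K) := by
    simp only [l, Finset.length_toList]
    exact Finset.card_le_univ _
  have hNR : (N : ℝ) + 1 ≤ 2 * 12 ^ m * R := by
    have h1 : (N : ℝ) ≤ 12 ^ m * R := Nat.floor_le (by positivity)
    have h2 : 1 ≤ 12 ^ m * R := one_le_mul_of_one_le_of_one_le (one_le_pow₀ (by norm_num)) hR
    linarith
  set c := (1 / gridStep m) ^ (2 * m - 3)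
  have hlogpow : 1 ≤ (1 + Real.log κ) ^ (2 * m - 3) := one_le_pow₀ (by linarith)
  set S := (1 + Real.log κ) ^ (2 * m - 3)
  calc ((OracleProgram.queries agd f (A (f z.1)) + 1 : ℕ) : ℝ)
      ≤ ((l.length * (N + 1) + 1 : ℕ) : ℝ) := by exact_mod_cast Nat.add_le_add_right h.2.2 1
    _ = l.length * ((N : ℝ) + 1) + 1 := by push_cast; ring
    _ ≤ (c * S) * (2 * 12 ^ m * R) + R * S := by
        have hlS : (l.length : ℝ) ≤ c * S := (Nat.cast_le.2 hlen).trans hcard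
        gcongr
        · exact (Nat.cast_nonneg _).trans hlS
        · exact one_le_mul_of_one_le_of_one_le hR hlogpow
    _ = _ := by ring

lemma searchPrec_nonneg (m : ℕ) : 0 ≤ searchPrec m := by unfold searchPrec; positivity

lemma searchPrec_le_searchConst (m : ℕ) [NeZero m] : searchPrec m ≤ searchConst m := by
  have := gridStep_pos (m := m)
  have : 0 ≤ 2 * (12 : ℝ) ^ m * (1 / gridStep m) ^ (2 * m - 3) := by positivity
  unfold searchConst
  linarith

theorem exists_program_unknown_parameters (m : ℕ) [NeZero m] (d : ℕ) (lo hi π ε Ψ : ℝ)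
    (z : Vec d × Vec d) (hε : 0 < ε) :
    ∃ A : OracleProgram (Vec d), ∀ (Q : MultiscaleProblem d m) (xstar : Vec d),
      Q.μ 0 = lo → Q.L (lastScale m) = hi → ∏ i, Q.cond i = π →
      IsMinOn Q.obj Set.univ xstar → Q.psi xstar z ≤ Ψ →
      ∀ (δ : ℝ) (agd : AGDRoutine d), 0 < δ →
        (∀ L μ : ℝ, lo ≤ μ → μ ≤ L → L ≤ hi → AccurateAt Q.obj δ agd L μ) →
        (searchConst m * acRate m π (hi / lo) (Ψ / ε) *
              max ((hi / lo) ^ (2 * (2 * m - 1)))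
                (max ((hi / lo) ^ (2 * (2 * m - 1)) * (Ψ / ε))
                  (hi * (hi / lo) * (‖xstar‖ ^ 2 / ε))) ≤ δ⁻¹ ∨
          (z = (0, 0) ∧
            searchConst m * acRate m π (hi / lo) (Ψ / ε) *
              ((hi / lo) ^ (2 * (2 * m - 1)) * (Ψ / ε)) ≤ δ⁻¹)) →
        Q.psi xstar (A.run agd Q.obj, A.run agd Q.obj) ≤ 3 * ε ∧
          (A.queries agd Q.obj : ℝ) ≤
            searchConst m * acRate m π (hi / lo) (Ψ / ε) *
              (1 + Real.log (hi / lo)) ^ (2 * m - 3) := by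
  -- The data are arbitrary reals: if no problem has them, any program will do; otherwise they
  -- satisfy `0 < lo ≤ hi` and `1 ≤ π`.
  by_cases hQ : ∃ Q : MultiscaleProblem d m,
      Q.μ 0 = lo ∧ Q.L (lastScale m) = hi ∧ ∏ i, Q.cond i = π
  swap
  · exact ⟨.output 0, fun Q xstar h1 h2 h3 => absurd ⟨Q, h1, h2, h3⟩ hQ⟩
  obtain ⟨hlo, hhi, hπ⟩ : 0 < lo ∧ lo ≤ hi ∧ 1 ≤ π := by
    obtain ⟨Q, rfl, rfl, rfl⟩ := hQ
    refine ⟨Q.μ_pos 0, (Q.μ_le_L 0).trans (Q.le_L_last 0), ?_⟩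
    calc (1 : ℝ) = ∏ _i : Fin m, 1 := by simp
      _ ≤ _ := Finset.prod_le_prod (fun _ _ => zero_le_one) fun i _ =>
        (one_le_div (Q.μ_pos i)).2 (Q.μ_le_L i)
  have hκ : 1 ≤ hi / lo := (one_le_div hlo).2 hhi
  have hl : 0 ≤ Real.log (hi / lo) := Real.log_nonneg hκ
  have hC := searchPrec_le_searchConst m
  have hC0 := searchPrec_nonneg m
  have hR : 0 ≤ acRate m π (hi / lo) (Ψ / ε) := by
    unfold acRate
    positivity
  -- If `2Ψ ≤ 3ε`, the start already suffices, since `ψ(x, x) ≤ 2 (f(x) - f(x⋆)) ≤ 2Ψ`. Otherwise `ε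
  -- ≤ Ψ`, as the analysis of the guesses requires.
  rcases le_total (2 * Ψ) (3 * ε) with hΨ | hΨ
  · refine ⟨.output z.1, fun Q xstar h1 h2 h3 hmin hψ δ agd hδ hagd hprec => ⟨?_, ?_⟩⟩
    · have := psi_self_le hmin z.1
      have := obj_sub_le_sum_pot Q.admissible_self hmin z
      rw [← psi_eq_sum_pot] at this
      simp only [OracleProgram.run]
      linarith
    · simp only [OracleProgram.queries, Nat.cast_zero]
      have : 0 ≤ searchConst m := hC0.trans hC
      positivity
  have hΨε : ε ≤ Ψ := by linarith
  obtain ⟨A, hA⟩ := exists_search_program (m := m) hlo hhi hπ (ε := ε) (Ψ := Ψ) z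
  refine ⟨A, fun Q xstar h1 h2 h3 hmin hψ δ agd hδ hagd hprec => ⟨?_, ?_⟩⟩
  swap
  · refine (hA agd Q.obj).2.trans ?_
    gcongr
    unfold searchConst
    linarith
  have hΨ0 : 0 < Ψ := hε.trans_le hΨε
  set R := acRate m π (hi / lo) (Ψ / ε)
  set W := (hi / lo) ^ (2 * (2 * m - 1)) with hW
  have hW0 : 0 ≤ W := by positivity
  have hX0 : 0 ≤ hi * (hi / lo) * (‖xstar‖ ^ 2 / ε) := by
    have : 0 ≤ hi := hlo.le.trans hhi
    positivity
  have hprec' : δ * (searchPrec m * R * (W * (Ψ / ε))) ≤ 1 ∧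
      δ * (searchPrec m * R * (hi * (hi / lo) * (‖xstar‖ ^ 2 / ε))) ≤ 1 := by
    have key : ∀ {a b : ℝ}, 0 ≤ a → a ≤ b → searchConst m * R * b ≤ δ⁻¹ →
        δ * (searchPrec m * R * a) ≤ 1 := by
      intro a b ha hab h
      rw [← mul_one δ⁻¹, le_inv_mul_iff₀ hδ] at h
      refine le_trans ?_ h
      have := hC0.trans hC
      gcongr
    have hWΨ : 0 ≤ W * (Ψ / ε) := by positivity
    rcases hprec with h | ⟨rfl, h⟩
    · exact ⟨key hWΨ ((le_max_left _ _).trans (le_max_right _ _)) h,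
        key hX0 ((le_max_right _ _).trans (le_max_right _ _)) h⟩
    · refine ⟨key hWΨ le_rfl h, key hX0 ?_ h⟩
      have hx := Q.mul_sum_gap_sq_le Q.admissible_self hmin 0
      rw [zero_sub, norm_neg, ← psi_eq_sum_pot, h1] at hx
      have hx' := hx.trans hψ
      have hW2 : (hi / lo) ^ 2 ≤ W := pow_le_pow_right₀ hκ (by have := NeZero.pos m; omega)
      calc hi * (hi / lo) * (‖xstar‖ ^ 2 / ε)
          = (hi / lo) ^ 2 * (lo * ‖xstar‖ ^ 2 / ε) := by field_simp
        _ ≤ W * (Ψ / ε) := by gcongr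
  -- The good grid point depends on `Q` and is used only in the analysis; `A` was fixed before `Q`.
  have hgrid := exists_admissible_grid Q
  rw [h1, h2, h3] at hgrid
  obtain ⟨g, hg⟩ := hgrid
  have h4 := (hA agd Q.obj).1 g hg.μ_le_L
  have h5 := sum_pot_acbsls_guess_le hg hmin hδ
    (fun i => hagd _ _ (hg.lo_le i) (hg.μ_le_L i) (hg.le_hi i))
    (prod_grid_le hlo (hlo.trans_le hhi) (by linarith) g) hε hψ hΨε hprec'.1 hprec'.2
  have h6 := obj_sub_le_sum_pot hg hmin (acbsls agd (gridL hi g) (gridμ lo hi π g)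
    (guessIters (gridL hi g) (gridμ lo hi π g) (hi / lo) (Ψ / ε)) 0 z)
  have h7 := psi_self_le hmin (A.run agd Q.obj)
  linarith

theorem mainTheorem6 :
    -- known parameters
    (∀ (d m : ℕ) [NeZero m] (Q : MultiscaleProblem d m) (xstar : Vec d),
      IsMinOn Q.obj Set.univ xstar →
      ∀ (ε : ℝ), 0 < ε → ∀ (T : Fin m → ℕ),
        -- arbitrary initialization
        (∀ z₀ : Vec d × Vec d, Q.IterBounds (Q.psi xstar z₀) ε T →
          (∀ (δ : ℝ) (agd : AGDRoutine d), 0 < δ → δ < 1 →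
            (∀ i, AccurateAt Q.obj δ agd (Q.L i) (Q.μ i)) →
            Q.precGeneral xstar z₀ ε T ≤ δ⁻¹ →
            Q.psi xstar (acbsls agd Q.L Q.μ T 0 z₀) ≤ 3 * ε) ∧
          (∀ p : ℕ, Real.logb 2 (Q.precGeneral xstar z₀ ε T) ≤ p →
            Q.psi xstar (acbsls (roundedAGD p Q.obj) Q.L Q.μ T 0 z₀) ≤ 3 * ε)) ∧
        -- initialization at zero
        (Q.IterBounds (Q.psi xstar (0, 0)) ε T →
          (∀ (δ : ℝ) (agd : AGDRoutine d), 0 < δ → δ < 1 →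
            (∀ i, AccurateAt Q.obj δ agd (Q.L i) (Q.μ i)) →
            Q.precZero xstar ε T ≤ δ⁻¹ →
            min (Q.psi xstar (0, 0)) (Q.psi xstar (acbsls agd Q.L Q.μ T 0 (0, 0))) ≤ 3 * ε) ∧
          (∀ p : ℕ, Real.logb 2 (Q.precZero xstar ε T) ≤ p →
            min (Q.psi xstar (0, 0))
              (Q.psi xstar (acbsls (roundedAGD p Q.obj) Q.L Q.μ T 0 (0, 0))) ≤ 3 * ε))) ∧
    -- only `m`, `μ₁`, `L_m` and `π = ∏ κᵢ` are known
    (∀ (m : ℕ) [NeZero m], ∃ C : ℝ, 0 < C ∧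
      ∀ (d : ℕ) (μ₁ Lm π ε Ψ : ℝ) (z₀ : Vec d × Vec d), 0 < ε →
        ∃ A : OracleProgram (Vec d),
          ∀ (Q : MultiscaleProblem d m) (xstar : Vec d),
            Q.μ 0 = μ₁ → Q.L (lastScale m) = Lm → ∏ i, Q.cond i = π →
            IsMinOn Q.obj Set.univ xstar → Q.psi xstar z₀ ≤ Ψ →
            ∀ (δ : ℝ) (agd : AGDRoutine d), 0 < δ → δ < 1 →
              (∀ L μ : ℝ, μ₁ ≤ μ → μ ≤ L → L ≤ Lm → AccurateAt Q.obj δ agd L μ) →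
              (C * acRate m π (Lm / μ₁) (Ψ / ε) *
                    max ((Lm / μ₁) ^ (2 * (2 * m - 1)))
                      (max ((Lm / μ₁) ^ (2 * (2 * m - 1)) * (Ψ / ε))
                        (Lm * (Lm / μ₁) * (‖xstar‖ ^ 2 / ε))) ≤ δ⁻¹ ∨
                (z₀ = (0, 0) ∧
                  C * acRate m π (Lm / μ₁) (Ψ / ε) *
                    ((Lm / μ₁) ^ (2 * (2 * m - 1)) * (Ψ / ε)) ≤ δ⁻¹)) →
              Q.psi xstar (A.run agd Q.obj, A.run agd Q.obj) ≤ 3 * ε ∧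
                (A.queries agd Q.obj : ℝ) ≤
                  C * acRate m π (Lm / μ₁) (Ψ / ε) * (1 + Real.log (Lm / μ₁)) ^ (2 * m - 3)) := by
  refine ⟨fun d m _ Q xstar hmin ε hε T => ⟨fun z₀ hT => ⟨fun δ agd hδ _ hagd hB => ?_,
    fun p hp => ?_⟩, fun hT => ⟨fun δ agd hδ _ hagd hB => ?_, fun p hp => ?_⟩⟩,
    fun m _ => ⟨searchConst m, ?_, fun d lo hi π ε Ψ z₀ hε => ?_⟩⟩
  · exact Q.psi_acbsls_le hmin hε hT hδ hagd hB
  · exact Q.psi_acbsls_le hmin hε hT (by positivity)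
      (fun i => accurateAt_roundedAGD p Q.obj _ _)
      ((le_two_pow_of_logb_le (Q.precGeneral_nonneg z₀ ε T) hp).trans_eq (inv_inv _).symm)
  · exact Q.min_psi_acbsls_le hmin hε hT hδ hagd hB
  · exact Q.min_psi_acbsls_le hmin hε hT (by positivity)
      (fun i => accurateAt_roundedAGD p Q.obj _ _)
      ((le_two_pow_of_logb_le (Q.precZero_nonneg hmin hε T) hp).trans_eq (inv_inv _).symm)
  · have := gridStep_pos (m := m)
    have := searchPrec_nonneg m
    unfold searchConst
    positivity
  · obtain ⟨A, hA⟩ := exists_program_unknown_parameters m d lo hi π ε Ψ z₀ hε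
    exact ⟨A, fun Q xstar h1 h2 h3 hmin hψ δ agd hδ _ hagd hprec =>
      hA Q xstar h1 h2 h3 hmin hψ δ agd hδ hagd hprec⟩
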